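/- Consider a branching random walk on $\mathbb{Z}$: it starts with one particle at $0$, and at each time step every particle is replaced, independently of all other particles and of the past, by a random finite cluster of descendants whose displacements from the position of the parent are distributed according to a fixed point process on $\mathbb{Z}$ (the number of descendants may be random and may depend on the displacements). Let $L_n(k)$ be the number of particles at site $k\in\mathbb{Z}$ at time $n\in\mathbb{N}_0$, let $\vartheta_n(\{k\})=\mathbb{E}L_n(k)$, and let $$\varphi(\beta)=\log\mathbb{E}\Big[\sum_{k\in\mathbb{Z}}e^{\beta k}L_1(k)\Big],\qquad \beta\in\mathbb{R}.$$ Assume: (A) the set $\{k\in\mathbb{Z}:\vartheta_1(\{k\})>0\}$ has at least two elements; (C) $\varphi$ is finite in some open interval containing $0$; (E) there are no integers $h\ge 2$ and $a$ such that $\vartheta_1$ is concentrated on $a+h\mathbb{Z}$. Let $\mathcal{D}_\varphi$ be the maximal open interval on which $\varphi$ is finite. For $\beta\in\mathcal{D}_\varphi$ put $\kappa_j(\beta)=\varphi^{(j)}(\beta)$ for $j\ge 1$, $\mu(\beta)=\kappa_1(\beta)$, $\sigma(\beta)=\sqrt{\kappa_2(\beta)}$ and $$x_n(k)=x_n(k;\beta)=\frac{k-\mu(\beta)n}{\sigma(\beta)\sqrt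 n}.$$ Define polynomials $\tilde P_j(z;\beta)$ in $z$ by the formal identity $$\exp\Big\{\sum_{j=1}^\infty\frac{\kappa_{j+2}(\beta)}{(j+2)!}z^{j+2}u^j\Big\}=\sum_{j=0}^\infty\tilde P_j(z;\beta)u^j,$$ and the Edgeworth polynomials $q_j(x;\beta)$ by $$q_j(x;\beta)\,e^{-x^2/2}=\tilde P_j\Big(-\frac{1}{\sigma(\beta)}\frac{d}{dx};\beta\Big)e^{-x^2/2};$$ that is, $q_j(x;\beta)$ arises from $\tilde P_j(z;\beta)$ on replacing each power $z^l$ by $\sigma(\beta)^{-l}\mathrm{He}_l(x)$, where $\mathrm{He}_l$ is the $l$-th probabilist Hermite polynomial. Then $\mathbb{E}L_n(k)<\infty$ for all $n\in\mathbb{N}_0$ and $k\in\mathbb{Z}$, and for every $r\in\mathbb{N}_0$ and every compact set $K\subset\mathcal{D}_\varphi$, $$e^{\beta k-\varphi(\beta)n}\,\mathbb{E}L_n(k)=\frac{e^{-\frac12x_n(k)^2}}{\sigma(\beta)\sqrt{2\pi n}}\sum_{j=0}^r\frac{1}{n^{j/2}}q_j(x_n(k);\beta)+o\big(n^{-\frac{r+1}{2}}\big)\qquad(n\to\infty),$$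 where the $o$-term is uniform in $\beta\in K$ and $k\in\mathbb{Z}$. -/

import Mathlib

open MeasureTheory ProbabilityTheory Polynomial
open scoped ENNReal

/-- Finite point configurations on `ℤ` (with multiplicities) form a countable set, so its usual
sigma-algebra (generated by the counts of points at the sites) is the discrete one. -/
instance instMeasurableSpaceMultisetInt : MeasurableSpace (Multiset ℤ) := ⊤

/-- A branching random walk on `ℤ`. Particles carry Ulam-Harris labels in `List ℕ`
(the ancestor is `[]`, the `i`-th child of `u` is `u ++ [i]`), and `cluster u` is the point process
of the displacements of the children of the particle `u` relative to `u`. The clusters are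
independent and all have the same law as the cluster of the ancestor. -/
structure BranchingRandomWalk {Ω : Type*} [MeasurableSpace Ω] (P : Measure Ω) where
  cluster : List ℕ → Ω → Multiset ℤ
  measurable_cluster : ∀ u, Measurable (cluster u)
  indep_cluster : iIndepFun cluster P
  ident_cluster : ∀ u, IdentDistrib (cluster u) (cluster []) P P

namespace BranchingRandomWalk

variable {Ω : Type*} [MeasurableSpace Ω] {P : Measure Ω}

/-- The particles alive at time `n`, as pairs (label, position). The points of a cluster
are enumerated in increasing order in order to label the children. -/
def particles (X : BranchingRandomWalk P) : ℕ → Ω → List (List ℕ × ℤ)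
  | 0, _ => [([], 0)]
  | n + 1, ω => (X.particles n ω).flatMap fun p =>
      ((X.cluster p.1 ω).sort (· ≤ ·)).mapIdx fun i d => (p.1 ++ [i], p.2 + d)

/-- The occupation number `L_n(k)`: the number of particles at site `k` at time `n`. -/
def occupation (X : BranchingRandomWalk P) (n : ℕ) (k : ℤ) (ω : Ω) : ℕ :=
  ((X.particles n ω).map Prod.snd).count k

/-- The intensity `ϑ_n({k}) = E L_n(k)`, with values in `[0, ∞]`. -/
noncomputable def intensity (X : BranchingRandomWalk P) (n : ℕ) (k : ℤ) : ℝ≥0∞ :=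
  ∫⁻ ω, (X.occupation n k ω : ℝ≥0∞) ∂P

/-- The cumulant generating function `φ(β) = log E [∑ₖ e^{βk} L_1(k)]`, as an extended real. -/
noncomputable def phi (X : BranchingRandomWalk P) (β : ℝ) : EReal :=
  ENNReal.log (∫⁻ ω, ∑' k : ℤ, ENNReal.ofReal (Real.exp (β * k)) * (X.occupation 1 k ω : ℝ≥0∞) ∂P)

/-- `φ(β)` is finite. -/
def PhiFinite (X : BranchingRandomWalk P) (β : ℝ) : Prop :=
  X.phi β ≠ ⊤ ∧ X.phi β ≠ ⊥

/-- Assumption A: at least two sites are charged by `ϑ_1`. -/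
def AssumptionA (X : BranchingRandomWalk P) : Prop :=
  {k : ℤ | 0 < X.intensity 1 k}.Nontrivial

/-- Assumption C: `φ` is finite in some open interval containing `0`. -/
def AssumptionC (X : BranchingRandomWalk P) : Prop :=
  ∃ a b : ℝ, a < 0 ∧ 0 < b ∧ ∀ β ∈ Set.Ioo a b, X.PhiFinite β

/-- Assumption E: `ϑ_1` is not concentrated on any progression `a + hℤ` with `h ≥ 2`. -/
def AssumptionE (X : BranchingRandomWalk P) : Prop :=
  ¬ ∃ h a : ℤ, 2 ≤ h ∧ ∀ k : ℤ, 0 < X.intensity 1 k → ∃ l : ℤ, k = a + h * l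

/-- The maximal open interval on which `φ` is finite: the set where `φ` is finite is an
interval, since `φ` is convex, so this is its interior. -/
def domPhi (X : BranchingRandomWalk P) : Set ℝ :=
  interior {β | X.PhiFinite β}

/-- `φ` as a real function, meaningful where `φ` is finite. -/
noncomputable def phiReal (X : BranchingRandomWalk P) (β : ℝ) : ℝ :=
  (X.phi β).toReal

/-- The tilted cumulant `κ_j(β) = φ^{(j)}(β)`. -/
noncomputable def kappa (X : BranchingRandomWalk P) (j : ℕ) (β : ℝ) : ℝ :=
  iteratedDeriv j X.phiReal β

/-- `μ(β) = φ'(β)`. -/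
noncomputable def mean (X : BranchingRandomWalk P) (β : ℝ) : ℝ :=
  X.kappa 1 β

/-- `σ(β) = √φ''(β)`. -/
noncomputable def sigma (X : BranchingRandomWalk P) (β : ℝ) : ℝ :=
  Real.sqrt (X.kappa 2 β)

/-- The standardized coordinate `x_n(k) = (k - μ(β) n) / (σ(β) √n)`. -/
noncomputable def coord (X : BranchingRandomWalk P) (β : ℝ) (n : ℕ) (k : ℤ) : ℝ :=
  (k - X.mean β * n) / (X.sigma β * Real.sqrt n)

end BranchingRandomWalk

/-- The formal series `∑_{j ≥ 1} κ_{j+2} / (j+2)! z^{j+2} u^j` in `u`, with coefficients in the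
polynomial ring `ℝ[z]`. -/
noncomputable def edgeworthExponent (κ : ℕ → ℝ) : PowerSeries ℝ[X] :=
  PowerSeries.mk fun j =>
    if j = 0 then 0 else Polynomial.monomial (j + 2) (κ (j + 2) / (Nat.factorial (j + 2) : ℝ))

/-- The polynomials `P_j(z)` defined by the formal identity
`exp (∑_{j ≥ 1} κ_{j+2} / (j+2)! z^{j+2} u^j) = ∑_{j ≥ 0} P_j(z) u^j`. -/
noncomputable def edgeworthP (κ : ℕ → ℝ) (j : ℕ) : ℝ[X] :=
  PowerSeries.coeff j ((PowerSeries.exp ℝ[X]).subst (edgeworthExponent κ))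

/-- The Edgeworth polynomial `q_j` with cumulants `κ`, where `σ = √κ_2`: the function with
`q_j(x) e^{-x²/2} = P_j(-D/σ) e^{-x²/2}`, `D = d/dx`. As `(-D)^l e^{-x²/2} = He_l(x) e^{-x²/2}` with
the probabilist Hermite polynomials `He_l`, it arises from `P_j` by replacing `z^l` by
`He_l(x) / σ^l`. -/
noncomputable def edgeworthQ (κ : ℕ → ℝ) (j : ℕ) (x : ℝ) : ℝ :=
  (edgeworthP κ j).sum fun l a =>
    a / Real.sqrt (κ 2) ^ l * Polynomial.aeval x (Polynomial.hermite l)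

/-!
The expectation of the occupation numbers is governed by a many-to-one formula: the particles of
generation `n` are a function of the clusters attached to labels of length less than `n`, hence
independent of the clusters attached to labels of length `n`. Therefore the intensities `ϑ_n` are
the convolution powers of `ϑ_1` (`BranchingRandomWalk.intensity_succ`), and the statement is a local
limit theorem with Edgeworth corrections for the exponentially tilted weight
`k ↦ e^{βk - φ(β)} ϑ_1({k})`.

Let `M(z) = ∑ₖ ϑ_1({k}) e^{zk}`, which is analytic on the strip over `𝒟_φ` and equals `e^φ` on its
real points. Fourier inversion (`fourier_inversion_convolution_power`) writes
`e^{βk - φ(β)n} ϑ_n({k})` as the integral of `e^{-ikt} (M(β + it) / M(β))^n / 2π` over `(-π, π]`. The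
right-hand side of the expansion is the same integral, now over the whole line, of the Edgeworth
approximation `edgeworthChar` (`integral_edgeworthChar`), because the Fourier transform of
`(is)^l e^{-s²/2}` is a Hermite polynomial times a Gaussian. It remains to compare the two
integrands.

Near `t = 0` the logarithm of `M(β + it)` has a Taylor expansion with remainder uniform in `β ∈ K`
(`exists_norm_log_sub_taylor_le`), whose coefficients are the tilted cumulants. Exponentiating `n`
times this expansion at `t = y / √n` is an operation on formal power series in `1 / √n`, with a
remainder controlled by `exists_norm_exp_sub_sum_expCoeff_le`; the effective parameter is
`(1 + |y|)³ / √n`, and a Gaussian factor in `y` survives, so the error of order `n^{-(r+1)/2}` is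
integrable (`exists_norm_exp_sub_edgeworthChar_le`). Away from `t = 0` the quotient
`|M(β + it)| / M(β)` is bounded by some `q < 1` on `K`, by compactness and since `ϑ_1` is not
concentrated on a proper progression (`norm_siteMGF_lt`). The substitution `y = √n t` gains one more
factor `n^{-1/2}`, so the total error is `O(n^{-(r+2)/2} + q^n)`
(`exists_abs_sub_edgeworth_le`).
-/

/-! ### The intensity of generation `n` as a convolution power -/

theorem ENNReal.sum_map_eq_tsum_count_mul {α : Type*} [BEq α] [LawfulBEq α] (l : List α) (f : α → ℝ≥0∞) :
    (l.map f).sum = ∑' a, (l.count a : ℝ≥0∞) * f a := by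
  classical
  induction l with
  | nil => simp
  | cons b l ih =>
    rw [List.map_cons, List.sum_cons, ih]
    have h (a : α) : (((b :: l).count a : ℕ) : ℝ≥0∞) * f a
        = (if a = b then f b else 0) + (l.count a : ℝ≥0∞) * f a := by
      rw [List.count_cons]
      by_cases hab : a = b
      · subst hab; simp [add_mul, add_comm]
      · have : ¬ b = a := fun h => hab h.symm
        simp [hab, this]
    simp_rw [h, ENNReal.tsum_add, tsum_ite_eq]

/-- Passing from one generation to the next is measurable if the clusters involved are. -/
theorem measurable_flatMap_children {Ω : Type*} [MeasurableSpace Ω]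
    {c : List ℕ → Ω → Multiset ℤ} {g : Ω → List (List ℕ × ℤ)} (hg : Measurable[_, ⊤] g)
    (hc : ∀ ω, ∀ p ∈ g ω, Measurable (c p.1)) :
    Measurable[_, ⊤] fun ω => (g ω).flatMap fun p =>
      ((c p.1 ω).sort (· ≤ ·)).mapIdx fun i d => (p.1 ++ [i], p.2 + d) := by
  let _ : MeasurableSpace (List (List ℕ × ℤ)) := ⊤
  have key : ∀ l : List (List ℕ × ℤ), (∀ p ∈ l, Measurable (c p.1)) →
      Measurable fun ω => l.flatMap fun p =>
        ((c p.1 ω).sort (· ≤ ·)).mapIdx fun i d => (p.1 ++ [i], p.2 + d) := by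
    intro l hl
    induction l with
    | nil => exact measurable_const
    | cons p l ihl =>
      have h1 := ihl fun q hq => hl q (List.mem_cons_of_mem _ hq)
      have h2 := hl p List.mem_cons_self
      have h3 : Measurable fun c : Multiset ℤ × List (List ℕ × ℤ) =>
          ((c.1.sort (· ≤ ·)).mapIdx fun i d => (p.1 ++ [i], p.2 + d)) ++ c.2 :=
        measurable_of_countable _
      exact h3.comp (h2.prodMk h1)
  refine measurable_to_countable' fun l => ?_
  have : (fun ω => (g ω).flatMap fun p =>
        ((c p.1 ω).sort (· ≤ ·)).mapIdx fun i d => (p.1 ++ [i], p.2 + d)) ⁻¹' {l}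
      = ⋃ l' ∈ {l' : List (List ℕ × ℤ) | ∀ p ∈ l', Measurable (c p.1)},
        g ⁻¹' {l'} ∩ (fun ω => l'.flatMap fun p =>
          ((c p.1 ω).sort (· ≤ ·)).mapIdx fun i d => (p.1 ++ [i], p.2 + d)) ⁻¹' {l} := by
    ext ω
    simp only [Set.mem_preimage, Set.mem_singleton_iff, Set.mem_iUnion, Set.mem_inter_iff,
      Set.mem_ofPred_eq, exists_prop]
    exact ⟨fun h => ⟨_, hc ω, rfl, h⟩, fun ⟨l', _, h1, h2⟩ => h1 ▸ h2⟩
  rw [this]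
  exact MeasurableSet.biUnion (Set.to_countable _) fun l' hl' =>
    (hg (measurableSet_singleton _)).inter (key l' hl' (measurableSet_singleton _))

namespace BranchingRandomWalk

variable {Ω : Type*} [MeasurableSpace Ω] {P : Measure Ω}

theorem length_of_mem_particles (X : BranchingRandomWalk P) {n : ℕ} {ω : Ω} {p : List ℕ × ℤ}
    (hp : p ∈ X.particles n ω) : p.1.length = n := by
  induction n generalizing p with
  | zero => simp only [particles, List.mem_singleton] at hp; simp [hp]
  | succ n ih =>
    simp only [particles, List.mem_flatMap, List.mem_mapIdx] at hp
    obtain ⟨q, hq, i, hi, rfl⟩ := hp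
    simp [ih hq]

/-- Generation `n` is a function of the clusters of the particles of earlier generations. -/
theorem measurable_particles {Ω' : Type*} (m : MeasurableSpace Ω') [MeasurableSpace Ω']
    {P : Measure Ω'} (X : BranchingRandomWalk P) (n : ℕ)
    (h : ∀ u : List ℕ, u.length < n → Measurable[m] (X.cluster u)) :
    Measurable[m, ⊤] (X.particles n) := by
  induction n with
  | zero => exact @measurable_const _ _ ⊤ m _
  | succ n ih =>
    exact @measurable_flatMap_children Ω' m _ _ (ih fun u hu => h u (by omega)) fun ω p hp =>
      h _ (by rw [X.length_of_mem_particles hp]; omega)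

theorem measurable_count_particles (X : BranchingRandomWalk P) (n : ℕ) (p : List ℕ × ℤ) :
    Measurable fun ω => ((X.particles n ω).count p : ℝ≥0∞) :=
  (measurable_from_top (f := fun l : List (List ℕ × ℤ) => (l.count p : ℝ≥0∞))).comp
    (measurable_particles _ X n fun u _ => X.measurable_cluster u)

theorem measurable_count_cluster (X : BranchingRandomWalk P) (u : List ℕ) (k : ℤ) :
    Measurable fun ω => ((X.cluster u ω).count k : ℝ≥0∞) :=
  (measurable_from_top (f := fun c : Multiset ℤ => (c.count k : ℝ≥0∞))).comp
    (X.measurable_cluster u)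

theorem occupation_succ (X : BranchingRandomWalk P) (n : ℕ) (k : ℤ) (ω : Ω) :
    X.occupation (n + 1) k ω
      = ((X.particles n ω).map fun p => (X.cluster p.1 ω).count (k - p.2)).sum := by
  have h (p : List ℕ × ℤ) (s : Multiset ℤ) :
      (((s.sort (· ≤ ·)).mapIdx fun i d => (p.1 ++ [i], p.2 + d)).map Prod.snd).count k
        = s.count (k - p.2) := by
    have : ((s.sort (· ≤ ·)).mapIdx fun i d => (p.1 ++ [i], p.2 + d)).map Prod.snd
        = (s.sort (· ≤ ·)).map fun d => p.2 + d := by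
      apply List.ext_getElem <;> simp
    rw [this]
    have h2 := List.count_map_of_injective (s.sort (· ≤ ·)) (fun d : ℤ => p.2 + d)
      (add_right_injective p.2) (k - p.2)
    simp only [add_sub_cancel] at h2
    rw [h2, ← Multiset.coe_count, Multiset.sort_eq]
  simp only [occupation, particles, List.map_flatMap, List.count_flatMap]
  congr 1
  exact List.map_congr_left fun p _ => h p _

theorem occupation_one (X : BranchingRandomWalk P) (k : ℤ) (ω : Ω) :
    X.occupation 1 k ω = (X.cluster [] ω).count k := by
  simp [occupation_succ, particles]

theorem measurable_occupation (X : BranchingRandomWalk P) (n : ℕ) (k : ℤ) :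
    Measurable fun ω => (X.occupation n k ω : ℝ≥0∞) :=
  (measurable_from_top
    (f := fun l : List (List ℕ × ℤ) => ((l.map Prod.snd).count k : ℝ≥0∞))).comp
    (measurable_particles _ X n fun u _ => X.measurable_cluster u)

theorem lintegral_count_cluster (X : BranchingRandomWalk P) (u : List ℕ) (k : ℤ) :
    ∫⁻ ω, ((X.cluster u ω).count k : ℝ≥0∞) ∂P = X.intensity 1 k := by
  simp only [intensity, occupation_one]
  exact ((X.ident_cluster u).comp
    (measurable_from_top (f := fun c : Multiset ℤ => (c.count k : ℝ≥0∞)))).lintegral_eq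

/-- The cluster of `u` is independent of the generation that `u` may belong to. -/
theorem lintegral_count_particles_mul (X : BranchingRandomWalk P) (n : ℕ) (u : List ℕ)
    (j k : ℤ) :
    ∫⁻ ω, ((X.particles n ω).count (u, j) : ℝ≥0∞) * ((X.cluster u ω).count k : ℝ≥0∞) ∂P
      = (∫⁻ ω, ((X.particles n ω).count (u, j) : ℝ≥0∞) ∂P) * X.intensity 1 k := by
  by_cases hu : u.length = n
  · let m : List ℕ → MeasurableSpace Ω := fun v => MeasurableSpace.comap (X.cluster v) ⊤
    have hm : ∀ v, m v ≤ ‹MeasurableSpace Ω› := fun v => (X.measurable_cluster v).comap_le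
    have hd : Disjoint {v : List ℕ | v.length < n} {u} := by
      rw [Set.disjoint_singleton_right]
      exact fun h : u.length < n => h.ne hu
    have hI := indep_iSup_of_disjoint (m := m) hm X.indep_cluster.iIndep hd
    rw [lintegral_mul_eq_lintegral_mul_lintegral_of_independent_measurableSpace
      (iSup₂_le fun v _ => hm v) (iSup₂_le fun v _ => hm v) hI, lintegral_count_cluster]
    · refine (measurable_from_top
        (f := fun l : List (List ℕ × ℤ) => (l.count (u, j) : ℝ≥0∞))).comp
        (measurable_particles _ X n fun v hv => ?_)
      exact Measurable.mono (comap_measurable _)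
        (le_iSup₂_of_le (f := fun v (_ : v ∈ {v : List ℕ | v.length < n}) => m v) v hv le_rfl) le_rfl
    · refine (measurable_from_top (f := fun c : Multiset ℤ => (c.count k : ℝ≥0∞))).comp ?_
      exact Measurable.mono (comap_measurable _)
        (le_iSup₂_of_le (f := fun v (_ : v ∈ ({u} : Set (List ℕ))) => m v) u rfl le_rfl) le_rfl
  · have h0 (ω : Ω) : (X.particles n ω).count (u, j) = 0 :=
      List.count_eq_zero.2 fun h => hu (X.length_of_mem_particles h)
    simp [h0]

theorem occupation_eq_tsum (X : BranchingRandomWalk P) (n : ℕ) (j : ℤ) (ω : Ω) :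
    (X.occupation n j ω : ℝ≥0∞) = ∑' u : List ℕ, ((X.particles n ω).count (u, j) : ℝ≥0∞) := by
  have h : (X.occupation n j ω : ℝ≥0∞)
      = ((X.particles n ω).map fun p => if p.2 = j then (1 : ℝ≥0∞) else 0).sum := by
    rw [occupation]
    induction X.particles n ω with
    | nil => simp
    | cons p l ih =>
      rw [List.map_cons, List.count_cons, List.map_cons, List.sum_cons, ← ih]
      by_cases hp : p.2 = j <;> simp [hp, add_comm]
  rw [h, ENNReal.sum_map_eq_tsum_count_mul, ENNReal.tsum_prod']
  refine tsum_congr fun u => ?_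
  rw [tsum_eq_single j (by intro b hb; simp [hb])]
  simp

/-- The intensity measures form a convolution semigroup: the many-to-one formula. -/
theorem intensity_succ (X : BranchingRandomWalk P) (n : ℕ) (k : ℤ) :
    X.intensity (n + 1) k = ∑' j, X.intensity n j * X.intensity 1 (k - j) := by
  have h (ω : Ω) : (X.occupation (n + 1) k ω : ℝ≥0∞) = ∑' p : List ℕ × ℤ,
      ((X.particles n ω).count p : ℝ≥0∞) * ((X.cluster p.1 ω).count (k - p.2) : ℝ≥0∞) := by
    rw [← ENNReal.sum_map_eq_tsum_count_mul (X.particles n ω)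
      fun p => ((X.cluster p.1 ω).count (k - p.2) : ℝ≥0∞), occupation_succ, Nat.cast_list_sum,
      List.map_map]
    rfl
  rw [intensity]
  simp_rw [h]
  rw [lintegral_tsum fun p : List ℕ × ℤ => ((X.measurable_count_particles n p).fun_mul
    (X.measurable_count_cluster p.1 (k - p.2))).aemeasurable]
  simp_rw [lintegral_count_particles_mul]
  rw [ENNReal.tsum_prod', ENNReal.tsum_comm]
  refine tsum_congr fun j => ?_
  have h2 : X.intensity n j = ∑' u, ∫⁻ ω, ((X.particles n ω).count (u, j) : ℝ≥0∞) ∂P := by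
    rw [← lintegral_tsum fun u => (X.measurable_count_particles n (u, j)).aemeasurable, intensity]
    simp_rw [← X.occupation_eq_tsum n j]
  rw [h2, ← ENNReal.tsum_mul_right]

theorem intensity_zero [IsProbabilityMeasure P] (X : BranchingRandomWalk P) (k : ℤ) :
    X.intensity 0 k = if k = 0 then 1 else 0 := by
  rcases eq_or_ne k 0 with rfl | hk
  · simp [intensity, occupation, particles]
  · have : ¬ (0 = k) := fun h => hk h.symm
    simp [intensity, occupation, particles, hk, this]

theorem lintegral_tsum_exp_mul_occupation (X : BranchingRandomWalk P) (β : ℝ) :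
    ∫⁻ ω, ∑' k : ℤ, ENNReal.ofReal (Real.exp (β * k)) * (X.occupation 1 k ω : ℝ≥0∞) ∂P
      = ∑' k : ℤ, ENNReal.ofReal (Real.exp (β * k)) * X.intensity 1 k := by
  rw [lintegral_tsum fun k => ((X.measurable_occupation 1 k).const_mul _).aemeasurable]
  exact tsum_congr fun k => lintegral_const_mul _ (X.measurable_occupation 1 k)

theorem phiFinite_iff (X : BranchingRandomWalk P) (β : ℝ) :
    X.PhiFinite β ↔ (∑' k : ℤ, ENNReal.ofReal (Real.exp (β * k)) * X.intensity 1 k) ≠ ⊤ ∧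
      (∑' k : ℤ, ENNReal.ofReal (Real.exp (β * k)) * X.intensity 1 k) ≠ 0 := by
  rw [PhiFinite, phi, lintegral_tsum_exp_mul_occupation, ne_eq, ENNReal.log_eq_top_iff, ne_eq,
    ENNReal.log_eq_bot_iff]

theorem tsum_intensity_ne_top [IsProbabilityMeasure P] (X : BranchingRandomWalk P)
    (h : X.PhiFinite 0) (n : ℕ) : ∑' k, X.intensity n k ≠ ⊤ := by
  have h1 : ∑' k, X.intensity 1 k ≠ ⊤ := by
    simpa using ((X.phiFinite_iff 0).1 h).1
  induction n with
  | zero => simp [intensity_zero]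
  | succ n ih =>
    simp_rw [intensity_succ X n]
    rw [ENNReal.tsum_comm]
    have (j : ℤ) : ∑' k, X.intensity n j * X.intensity 1 (k - j)
        = X.intensity n j * ∑' k, X.intensity 1 k := by
      rw [ENNReal.tsum_mul_left]
      congr 1
      exact (Equiv.subRight j).tsum_eq fun k => X.intensity 1 k
    simp_rw [this]
    rw [ENNReal.tsum_mul_right]
    exact ENNReal.mul_ne_top ih h1

theorem intensity_ne_top [IsProbabilityMeasure P] (X : BranchingRandomWalk P)
    (h : X.PhiFinite 0) (n : ℕ) (k : ℤ) : X.intensity n k ≠ ⊤ :=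
  ENNReal.ne_top_of_tsum_ne_top (X.tsum_intensity_ne_top h n) k

end BranchingRandomWalk

/-! ### The generating function of a weight on the integers -/

/-- The measure on `ℤ` with mass `c k` at the site `k`. -/
noncomputable def siteMeasure (c : ℤ → ℝ≥0∞) : Measure ℤ :=
  Measure.sum fun k => c k • Measure.dirac k

/-- The generating function `∑ₖ c k e^{zk}`, an analytic function of the complex variable `z` on the
vertical strip of convergence. -/
noncomputable def siteMGF (c : ℤ → ℝ≥0∞) (z : ℂ) : ℂ :=
  complexMGF (fun k : ℤ => (k : ℝ)) (siteMeasure c) z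

section SiteMeasure

variable {c : ℤ → ℝ≥0∞} {β : ℝ}

/-- The set of real parameters for which the generating function of `c` converges. -/
noncomputable abbrev siteExpSet (c : ℤ → ℝ≥0∞) : Set ℝ :=
  integrableExpSet (fun k : ℤ => (k : ℝ)) (siteMeasure c)

theorem siteMeasure_ne_zero {k : ℤ} (hk : 0 < c k) : siteMeasure c ≠ 0 := fun h => by
  have h1 : siteMeasure c {k} = 0 := by rw [h]; simp
  have h2 : c k ≤ siteMeasure c {k} := by
    rw [siteMeasure, Measure.sum_apply _ (measurableSet_singleton k)]
    refine le_trans ?_ (ENNReal.le_tsum k)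
    simp
  exact hk.not_ge (h1 ▸ h2)

theorem hasSum_integral_siteMeasure {E : Type*} [NormedAddCommGroup E] [NormedSpace ℝ E]
    [CompleteSpace E] (hc : ∀ k, c k ≠ ⊤) {f : ℤ → E} (hf : Integrable f (siteMeasure c)) :
    HasSum (fun k => (c k).toReal • f k) (∫ k, f k ∂siteMeasure c) :=
  hasSum_integral_sum_dirac hc ((integrable_sum_dirac_iff hc).1 hf)

theorem hasSum_mgf (hc : ∀ k, c k ≠ ⊤) (hβ : β ∈ siteExpSet c) :
    HasSum (fun k => (c k).toReal * Real.exp (β * k))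
      (mgf (fun k : ℤ => (k : ℝ)) (siteMeasure c) β) :=
  hasSum_integral_siteMeasure hc hβ

theorem hasSum_siteMGF (hc : ∀ k, c k ≠ ⊤) (hβ : β ∈ siteExpSet c) (t : ℝ) :
    HasSum (fun k : ℤ => ((c k).toReal : ℂ) * Complex.exp ((β + t * Complex.I) * k))
      (siteMGF c (β + t * Complex.I)) := by
  have h1 : Integrable (fun k : ℤ => Complex.exp ((β + t * Complex.I) * ((k : ℝ) : ℂ)))
      (siteMeasure c) := by
    refine (integrable_norm_iff (measurable_of_countable _).aestronglyMeasurable).1 ?_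
    refine hβ.congr (Filter.Eventually.of_forall fun k => ?_)
    simp [Complex.norm_exp]
  simpa [siteMGF, complexMGF] using hasSum_integral_siteMeasure hc h1

theorem siteMGF_ofReal (c : ℤ → ℝ≥0∞) (β : ℝ) :
    siteMGF c β = (mgf (fun k : ℤ => (k : ℝ)) (siteMeasure c) β : ℝ) :=
  complexMGF_ofReal β

theorem norm_siteMGF_le (c : ℤ → ℝ≥0∞) (β t : ℝ) :
    ‖siteMGF c (β + t * Complex.I)‖ ≤ mgf (fun k : ℤ => (k : ℝ)) (siteMeasure c) β := by
  have := norm_complexMGF_le_mgf (X := fun k : ℤ => (k : ℝ)) (μ := siteMeasure c)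
    (z := β + t * Complex.I)
  rwa [show (β + t * Complex.I : ℂ).re = β by simp] at this

theorem analyticAt_siteMGF {z : ℂ} (hz : z.re ∈ interior (siteExpSet c)) :
    AnalyticAt ℂ (siteMGF c) z :=
  analyticAt_complexMGF hz

/-- A set of integers that lies in no progression `a + hℤ` with `h ≥ 2`. -/
def Aperiodic (s : Set ℤ) : Prop :=
  ¬ ∃ h a : ℤ, 2 ≤ h ∧ ∀ k ∈ s, ∃ l : ℤ, k = a + h * l

theorem Aperiodic.nontrivial {s : Set ℤ} (hs : Aperiodic s) : s.Nontrivial := by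
  by_contra h
  rw [Set.not_nontrivial_iff] at h
  rcases s.eq_empty_or_nonempty with rfl | ⟨a, ha⟩
  · exact hs ⟨2, 0, le_rfl, by simp⟩
  · exact hs ⟨2, a, le_rfl, fun k hk => ⟨0, by simpa using h hk ha⟩⟩

/-- A character of `ℤ` that is constant on an aperiodic set is trivial. -/
theorem Aperiodic.exp_eq_one {s : Set ℤ} (hs : Aperiodic s) {t : ℝ} {a : ℤ}
    (h : ∀ k ∈ s, Complex.exp (t * Complex.I * (k - a : ℤ)) = 1) :
    Complex.exp (t * Complex.I) = 1 := by
  let H : AddSubgroup ℤ :=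
    { carrier := {m | Complex.exp (t * Complex.I * m) = 1}
      zero_mem' := by simp
      add_mem' := fun {x y} hx hy => by
        have hx : Complex.exp (t * Complex.I * x) = 1 := hx
        have hy : Complex.exp (t * Complex.I * y) = 1 := hy
        change Complex.exp (t * Complex.I * (x + y : ℤ)) = 1
        push_cast
        rw [mul_add, Complex.exp_add, hx, hy, mul_one]
      neg_mem' := fun {x} hx => by
        have hx : Complex.exp (t * Complex.I * x) = 1 := hx
        change Complex.exp (t * Complex.I * (-x : ℤ)) = 1
        push_cast
        rw [mul_neg, Complex.exp_neg, hx, inv_one] }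
  obtain ⟨g, hg⟩ := Int.subgroup_cyclic H
  have hmem : ∀ k ∈ s, ∃ l : ℤ, k - a = g * l := by
    intro k hk
    have : k - a ∈ H := h k hk
    rw [hg, AddSubgroup.mem_closure_singleton] at this
    obtain ⟨l, hl⟩ := this
    exact ⟨l, by rw [← hl, smul_eq_mul, mul_comm]⟩
  by_contra hne
  have hg1 : (1 : ℤ) ∉ H := fun h1 => hne (by
    have : Complex.exp (t * Complex.I * (1 : ℤ)) = 1 := h1
    simpa using this)
  have hg2 : |g| ≠ 1 := fun h1 => hg1 (by
    rw [hg, AddSubgroup.mem_closure_singleton]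
    rcases abs_eq (zero_le_one' ℤ) |>.1 h1 with h2 | h2
    · exact ⟨1, by simp [h2]⟩
    · exact ⟨-1, by simp [h2]⟩)
  rcases eq_or_ne g 0 with h0 | h0
  · refine hs ⟨2, a, le_rfl, fun k hk => ⟨0, ?_⟩⟩
    obtain ⟨l, hl⟩ := hmem k hk
    rw [h0] at hl
    omega
  · refine hs ⟨|g|, a, by have := abs_pos.2 h0; omega, fun k hk => ?_⟩
    obtain ⟨l, hl⟩ := hmem k hk
    rcases abs_choice g with h2 | h2
    · exact ⟨l, by rw [h2]; omega⟩
    · exact ⟨-l, by rw [h2]; linarith⟩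

/-- Away from the real axis (modulo `2πi`) the generating function of an aperiodic weight is
strictly dominated by its value on the real axis. -/
theorem norm_siteMGF_lt (hc : ∀ k, c k ≠ ⊤) (hs : Aperiodic {k | 0 < c k}) (hβ : β ∈ siteExpSet c)
    {t : ℝ} (ht0 : t ≠ 0) (ht : |t| ≤ Real.pi) :
    ‖siteMGF c (β + t * Complex.I)‖ < mgf (fun k : ℤ => (k : ℝ)) (siteMeasure c) β := by
  have hS := hasSum_mgf hc hβ
  have hM := hasSum_siteMGF hc hβ t
  set M := siteMGF c (β + t * Complex.I)
  set S := mgf (fun k : ℤ => (k : ℝ)) (siteMeasure c) β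
  have hle : ‖M‖ ≤ S := norm_siteMGF_le c β t
  refine lt_of_le_of_ne hle fun heq => ?_
  -- rotate `M` onto the positive half-line
  obtain ⟨e, he, heM⟩ : ∃ e : ℂ, ‖e‖ = 1 ∧ e * M = (S : ℂ) := by
    rcases eq_or_ne M 0 with h0 | h0
    · exact ⟨1, by simp, by rw [h0, ← heq, h0]; simp⟩
    · refine ⟨S / M, ?_, by field_simp⟩
      rw [norm_div, Complex.norm_real, heq, Real.norm_of_nonneg (heq ▸ norm_nonneg M)]
      exact div_self (heq ▸ norm_ne_zero_iff.2 h0)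
  have hE (k : ℤ) : ((c k).toReal : ℂ) * Complex.exp ((β + t * Complex.I) * k)
      = ((c k).toReal * Real.exp (β * k) : ℝ) * Complex.exp (t * Complex.I * k) := by
    rw [add_mul, Complex.exp_add]; push_cast; ring
  have hdiff : HasSum (fun k : ℤ => (c k).toReal * Real.exp (β * k)
      * (1 - (e * Complex.exp (t * Complex.I * k)).re)) 0 := by
    have h1 := hS.sub (Complex.hasSum_re (hM.mul_left e))
    rw [heM, Complex.ofReal_re, sub_self] at h1
    refine Eq.mp (congrArg (fun f => HasSum f (0 : ℝ)) (funext fun k => ?_)) h1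
    rw [hE, mul_left_comm, Complex.re_ofReal_mul]
    ring
  have hnorm (k : ℤ) : ‖e * Complex.exp (t * Complex.I * k)‖ = 1 := by
    rw [norm_mul, he, one_mul, Complex.norm_exp]
    simp
  have hnn (k : ℤ) : 0 ≤ (c k).toReal * Real.exp (β * k)
      * (1 - (e * Complex.exp (t * Complex.I * k)).re) := by
    have := Complex.re_le_norm (e * Complex.exp (t * Complex.I * k))
    rw [hnorm] at this
    have : 0 ≤ 1 - (e * Complex.exp (t * Complex.I * k)).re := by linarith
    positivity
  have hzero := (hasSum_zero_iff_of_nonneg hnn).1 hdiff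
  have hone : ∀ k, 0 < c k → e * Complex.exp (t * Complex.I * k) = 1 := by
    intro k hk
    have h0 := congrFun hzero k
    have hck : 0 < (c k).toReal := ENNReal.toReal_pos hk.ne' (hc k)
    have hre : (e * Complex.exp (t * Complex.I * k)).re = 1 := by
      rcases mul_eq_zero.1 h0 with h | h
      · exact absurd h (by positivity)
      · linarith
    have him : (e * Complex.exp (t * Complex.I * k)).im = 0 := by
      have h1 := Complex.sq_norm (e * Complex.exp (t * Complex.I * k))
      rw [hnorm, Complex.normSq_apply, hre] at h1
      nlinarith
    exact Complex.ext hre him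
  obtain ⟨a, ha⟩ := hs.nontrivial.nonempty
  have hexp : Complex.exp (t * Complex.I) = 1 := hs.exp_eq_one (a := a) fun k hk => by
    have h1 := hone k hk
    have h2 := hone a ha
    have he0 : e ≠ 0 := fun h => by simp [h] at he
    push_cast
    rw [mul_sub, Complex.exp_sub, div_eq_one_iff_eq (Complex.exp_ne_zero _)]
    exact mul_left_cancel₀ he0 (h1.trans h2.symm)
  rw [Complex.exp_eq_one_iff] at hexp
  obtain ⟨n, hn⟩ := hexp
  have hn' : t = n * (2 * Real.pi) := by
    have := congrArg Complex.im hn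
    simpa using this
  have hn0 : n ≠ 0 := fun h => ht0 (by rw [hn', h]; simp)
  have h1 : (1 : ℝ) ≤ |(n : ℝ)| := by exact_mod_cast Int.one_le_abs hn0
  have hpi := Real.pi_pos
  rw [hn', abs_mul, abs_of_pos (by positivity : 0 < 2 * Real.pi)] at ht
  nlinarith

/-- The variance of the tilted weight is positive. -/
theorem iteratedDeriv_two_cgf_pos (hc : ∀ k, c k ≠ ⊤) (hs : {k | 0 < c k}.Nontrivial)
    (hβ : β ∈ interior (siteExpSet c)) :
    0 < iteratedDeriv 2 (cgf (fun k : ℤ => (k : ℝ)) (siteMeasure c)) β := by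
  rw [iteratedDeriv_two_cgf_eq_integral hβ]
  set m := deriv (cgf (fun k : ℤ => (k : ℝ)) (siteMeasure c)) β
  obtain ⟨k, hk, hkm⟩ : ∃ k, 0 < c k ∧ (k : ℝ) ≠ m := by
    obtain ⟨k, hk, l, hl, hkl⟩ := hs
    by_cases h : (k : ℝ) = m
    · exact ⟨l, hl, fun h2 => hkl (by exact_mod_cast h.trans h2.symm)⟩
    · exact ⟨k, hk, h⟩
  have hI : Integrable (fun k : ℤ => ((k : ℝ) - m) ^ 2 * Real.exp (β * k)) (siteMeasure c) := by
    have h2 := integrable_pow_mul_exp_of_mem_interior_integrableExpSet hβ 2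
    have h1 := integrable_pow_mul_exp_of_mem_interior_integrableExpSet hβ 1
    have h0 := integrable_pow_mul_exp_of_mem_interior_integrableExpSet hβ 0
    refine ((h2.sub (h1.const_mul (2 * m))).add (h0.const_mul (m ^ 2))).congr
      (Filter.Eventually.of_forall fun k => ?_)
    simp only [Pi.add_apply, Pi.sub_apply]
    ring
  have hsum := hasSum_integral_siteMeasure hc hI
  have hck : 0 < (c k).toReal := ENNReal.toReal_pos hk.ne' (hc k)
  have hle := le_hasSum hsum k fun j _ => by simp only [smul_eq_mul]; positivity
  refine div_pos (lt_of_lt_of_le ?_ hle) (mgf_pos' (siteMeasure_ne_zero hk) (interior_subset (s := siteExpSet c) hβ))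
  have := sq_pos_of_ne_zero (sub_ne_zero.2 hkm)
  simp only [smul_eq_mul]
  positivity

theorem continuous_siteMGF_vertical (hβ : β ∈ interior (siteExpSet c)) :
    Continuous fun t : ℝ => siteMGF c (β + t * Complex.I) := by
  refine continuous_iff_continuousAt.2 fun t => ?_
  have h : AnalyticAt ℂ (siteMGF c) (β + t * Complex.I) := analyticAt_siteMGF (by simpa using hβ)
  exact ContinuousAt.comp (f := fun t : ℝ => (β + t * Complex.I : ℂ)) h.continuousAt (by fun_prop)

/-- Fourier inversion for the convolution powers `a n` of a weight `c` on `ℤ`. -/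
theorem fourier_inversion_convolution_power (hc : ∀ k, c k ≠ ⊤)
    (hβ : β ∈ interior (siteExpSet c)) {a : ℕ → ℤ → ℝ} (h0 : ∀ k, a 0 k = if k = 0 then 1 else 0)
    (hs : ∀ n k, HasSum (fun j => (c j).toReal * a n (k - j)) (a (n + 1) k)) (n : ℕ) (k : ℤ) :
    (2 * Real.pi : ℂ) * (Real.exp (β * k) * a n k : ℝ)
      = ∫ t in -Real.pi..Real.pi, Complex.exp (-(t * Complex.I * k))
          * siteMGF c (β + t * Complex.I) ^ n := by
  have hcont := continuous_siteMGF_vertical hβ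
  induction n generalizing k with
  | zero =>
    rcases eq_or_ne k 0 with rfl | hk
    · simp [h0]; ring
    · have hk' : -(Complex.I * k) ≠ 0 := by simp [hk]
      have h1 : ∀ t : ℝ, Complex.exp (-(t * Complex.I * k)) = Complex.exp (-(Complex.I * k) * t) :=
        fun t => by ring_nf
      simp only [pow_zero, mul_one, h1, h0, hk, if_false, mul_zero, Complex.ofReal_zero]
      rw [integral_exp_mul_complex hk', eq_comm, div_eq_zero_iff, sub_eq_zero]
      left
      rw [Complex.exp_eq_exp_iff_exists_int]
      exact ⟨-k, by push_cast; ring⟩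
  | succ n ih =>
    have hβ' := interior_subset hβ
    set S := mgf (fun k : ℤ => (k : ℝ)) (siteMeasure c) β
    have hMS (t : ℝ) : ‖siteMGF c (β + t * Complex.I)‖ ≤ S := norm_siteMGF_le c β t
    have h1 : HasSum (fun j : ℤ => ∫ t in -Real.pi..Real.pi,
        (((c j).toReal : ℂ) * Complex.exp ((β + t * Complex.I) * j))
          * (Complex.exp (-(t * Complex.I * k)) * siteMGF c (β + t * Complex.I) ^ n))
        (∫ t in -Real.pi..Real.pi, siteMGF c (β + t * Complex.I)
          * (Complex.exp (-(t * Complex.I * k)) * siteMGF c (β + t * Complex.I) ^ n)) := by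
      refine intervalIntegral.hasSum_integral_of_dominated_convergence
        (fun j _ => (c j).toReal * Real.exp (β * j) * S ^ n) (fun j => ?_) (fun j => ?_) ?_ ?_ ?_
      · exact Continuous.aestronglyMeasurable (by fun_prop)
      · refine Filter.Eventually.of_forall fun t _ => ?_
        rw [norm_mul, norm_mul, norm_mul, norm_pow, Complex.norm_exp, Complex.norm_exp]
        simp only [Complex.norm_real, Real.norm_eq_abs, abs_of_nonneg ENNReal.toReal_nonneg]
        have h2 : ((β + t * Complex.I) * j : ℂ).re = β * j := by simp
        have h3 : (-(t * Complex.I * k) : ℂ).re = 0 := by simp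
        rw [h2, h3, Real.exp_zero, one_mul]
        gcongr
        exact hMS t
      · exact Filter.Eventually.of_forall fun t _ => ((hasSum_mgf hc hβ').mul_right _).summable
      · exact intervalIntegrable_const
      · exact Filter.Eventually.of_forall fun t _ => (hasSum_siteMGF hc hβ' t).mul_right _
    have h2 : HasSum (fun j : ℤ => ((2 * Real.pi : ℂ)
        * (Real.exp (β * k) * ((c j).toReal * a n (k - j)) : ℝ)))
        ((2 * Real.pi : ℂ) * (Real.exp (β * k) * a (n + 1) k : ℝ)) :=
      (Complex.hasSum_ofReal.2 ((hs n k).mul_left _)).mul_left _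
    have h3 (j : ℤ) : (2 * Real.pi : ℂ) * (Real.exp (β * k) * ((c j).toReal * a n (k - j)) : ℝ)
        = ∫ t in -Real.pi..Real.pi, (((c j).toReal : ℂ) * Complex.exp ((β + t * Complex.I) * j))
          * (Complex.exp (-(t * Complex.I * k)) * siteMGF c (β + t * Complex.I) ^ n) := by
      have h4 : (Real.exp (β * k) * ((c j).toReal * a n (k - j)) : ℝ)
          = (c j).toReal * Real.exp (β * j) * (Real.exp (β * (k - j : ℤ)) * a n (k - j)) := by
        have : Real.exp (β * k) = Real.exp (β * j) * Real.exp (β * (k - j : ℤ)) := by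
          rw [← Real.exp_add]; push_cast; ring_nf
        rw [this]; ring
      rw [h4, Complex.ofReal_mul, mul_left_comm, ih, ← intervalIntegral.integral_const_mul]
      refine intervalIntegral.integral_congr fun t _ => ?_
      have h5 : Complex.exp (-(t * Complex.I * (k - j : ℤ)))
          = Complex.exp (t * Complex.I * j) * Complex.exp (-(t * Complex.I * k)) := by
        rw [← Complex.exp_add]; push_cast; ring_nf
      simp only [h5, add_mul, Complex.exp_add]
      push_cast
      ring
    simp_rw [h3] at h2
    rw [h2.unique h1]
    refine intervalIntegral.integral_congr fun t _ => ?_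
    simp only [pow_succ]
    ring

end SiteMeasure

namespace BranchingRandomWalk

variable {Ω : Type*} [MeasurableSpace Ω] {P : Measure Ω}

theorem AssumptionE.aperiodic {X : BranchingRandomWalk P} (hE : X.AssumptionE) :
    Aperiodic {k | 0 < X.intensity 1 k} := hE

theorem lintegral_siteMeasure (X : BranchingRandomWalk P) (β : ℝ) :
    ∫⁻ k : ℤ, ENNReal.ofReal (Real.exp (β * k)) ∂siteMeasure (X.intensity 1)
      = ∑' k : ℤ, ENNReal.ofReal (Real.exp (β * k)) * X.intensity 1 k := by
  rw [siteMeasure, lintegral_sum_measure]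
  simp [mul_comm]

theorem phiFinite_iff_mem_siteExpSet {X : BranchingRandomWalk P} (hE : X.AssumptionE) (β : ℝ) :
    X.PhiFinite β ↔ β ∈ siteExpSet (X.intensity 1) := by
  rw [phiFinite_iff, ← lintegral_siteMeasure]
  obtain ⟨k, hk⟩ := hE.aperiodic.nontrivial.nonempty
  have hpos : ∫⁻ k : ℤ, ENNReal.ofReal (Real.exp (β * k)) ∂siteMeasure (X.intensity 1) ≠ 0 := by
    rw [lintegral_siteMeasure]
    refine (lt_of_lt_of_le ?_ (ENNReal.le_tsum k)).ne'
    exact ENNReal.mul_pos (by simp [Real.exp_pos]) (ne_of_gt hk)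
  have h1 := hasFiniteIntegral_iff_ofReal (μ := siteMeasure (X.intensity 1))
    (f := fun k : ℤ => Real.exp (β * k)) (Filter.Eventually.of_forall fun k => (Real.exp_pos _).le)
  refine ⟨fun h => ⟨(measurable_of_countable _).aestronglyMeasurable,
    h1.2 (lt_top_iff_ne_top.2 h.1)⟩, fun h => ⟨(h1.1 h.2).ne, hpos⟩⟩

theorem domPhi_eq {X : BranchingRandomWalk P} (hE : X.AssumptionE) :
    X.domPhi = interior (siteExpSet (X.intensity 1)) := by
  rw [domPhi]
  congr 1
  ext β
  exact phiFinite_iff_mem_siteExpSet hE β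

theorem phiReal_eq_cgf (X : BranchingRandomWalk P) :
    X.phiReal = cgf (fun k : ℤ => (k : ℝ)) (siteMeasure (X.intensity 1)) := by
  ext β
  rw [phiReal, phi, lintegral_tsum_exp_mul_occupation, ← lintegral_siteMeasure, cgf, mgf,
    integral_eq_lintegral_of_nonneg_ae (Filter.Eventually.of_forall fun k => (Real.exp_pos _).le)
      (measurable_of_countable _).aestronglyMeasurable]
  set x := ∫⁻ k : ℤ, ENNReal.ofReal (Real.exp (β * k)) ∂siteMeasure (X.intensity 1)
  rcases eq_or_ne x 0 with h0 | h0
  · simp [h0]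
  rcases eq_or_ne x ⊤ with h1 | h1
  · simp [h1]
  rw [ENNReal.log_pos_real h0 h1, EReal.toReal_coe]

theorem hasSum_intensity_succ [IsProbabilityMeasure P] (X : BranchingRandomWalk P)
    (h : X.PhiFinite 0) (n : ℕ) (k : ℤ) :
    HasSum (fun j => (X.intensity 1 j).toReal * (X.intensity n (k - j)).toReal)
      (X.intensity (n + 1) k).toReal := by
  have h1 : X.intensity (n + 1) k = ∑' j, X.intensity 1 j * X.intensity n (k - j) := by
    rw [intensity_succ, ← (Equiv.subLeft k).tsum_eq]
    exact tsum_congr fun j => by simp [mul_comm]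
  have h2 := X.intensity_ne_top h (n + 1) k
  rw [h1] at h2 ⊢
  have h3 := ENNReal.hasSum_toReal h2
  rw [← ENNReal.tsum_toReal_eq fun j => ENNReal.ne_top_of_tsum_ne_top h2 j] at h3
  simpa only [ENNReal.toReal_mul] using h3

end BranchingRandomWalk

/-! ### Truncated exponentials of power series -/

section FormalExp

open Finset

/-- The `j`-th coefficient of `exp A`, for a power series `A` without constant term and `j ≤ r`. -/
noncomputable def expCoeff (A : PowerSeries ℂ) (r j : ℕ) : ℂ :=
  ∑ d ∈ range (r + 1), (d.factorial : ℂ)⁻¹ * PowerSeries.coeff j (A ^ d)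

variable {T u : ℝ} {r : ℕ}

theorem norm_coeff_pow_le (hT : 0 ≤ T) {A : PowerSeries ℂ}
    (hA : ∀ j ≤ r, ‖PowerSeries.coeff j A‖ ≤ T ^ j) (d : ℕ) :
    ∀ j ≤ r, ‖PowerSeries.coeff j (A ^ d)‖ ≤ (r + 1 : ℝ) ^ d * T ^ j := by
  induction d with
  | zero =>
    intro j _
    rw [pow_zero, PowerSeries.coeff_one]
    split_ifs with h
    · simp [h]
    · simpa using pow_nonneg hT j
  | succ d ih =>
    intro j hj
    rw [pow_succ, PowerSeries.coeff_mul]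
    calc ‖∑ p ∈ antidiagonal j, PowerSeries.coeff p.1 (A ^ d) * PowerSeries.coeff p.2 A‖
        ≤ ∑ p ∈ antidiagonal j, (r + 1 : ℝ) ^ d * T ^ j := by
          refine norm_sum_le_of_le _ fun p hp => ?_
          rw [HasAntidiagonal.mem_antidiagonal] at hp
          rw [norm_mul, ← hp, pow_add, ← mul_assoc]
          exact mul_le_mul (ih _ (by omega)) (hA _ (by omega)) (norm_nonneg _) (by positivity)
      _ = (j + 1) * ((r + 1 : ℝ) ^ d * T ^ j) := by simp
      _ ≤ (r + 1) * ((r + 1 : ℝ) ^ d * T ^ j) := by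
          have : (j : ℝ) ≤ r := by exact_mod_cast hj
          gcongr
      _ = (r + 1 : ℝ) ^ (d + 1) * T ^ j := by ring

/-- Truncation after degree `r` is multiplicative up to terms of degree `r + 1`. -/
theorem norm_mul_sub_sum_coeff_mul_le (hT : 0 ≤ T) (hu : 0 ≤ u) (hTu : T * u ≤ 1) {F G : ℝ}
    (hF0 : 0 ≤ F) {f g : PowerSeries ℂ} (hf : ∀ j ≤ r, ‖PowerSeries.coeff j f‖ ≤ F * T ^ j)
    (hg : ∀ j ≤ r, ‖PowerSeries.coeff j g‖ ≤ G * T ^ j) :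
    ‖(∑ j ∈ range (r + 1), PowerSeries.coeff j f * (u : ℂ) ^ j)
        * (∑ j ∈ range (r + 1), PowerSeries.coeff j g * (u : ℂ) ^ j)
        - ∑ j ∈ range (r + 1), PowerSeries.coeff j (f * g) * (u : ℂ) ^ j‖
      ≤ (r + 1) ^ 2 * (F * G) * (T * u) ^ (r + 1) := by
  have h1 : ∑ j ∈ range (r + 1), PowerSeries.coeff j (f * g) * (u : ℂ) ^ j
      = ∑ p ∈ (range (r + 1) ×ˢ range (r + 1)) with p.1 + p.2 < r + 1,
        (PowerSeries.coeff p.1 f * (u : ℂ) ^ p.1) * (PowerSeries.coeff p.2 g * (u : ℂ) ^ p.2) := by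
    simp_rw [PowerSeries.coeff_mul, sum_mul]
    rw [sum_sigma']
    refine sum_nbij' (fun x => x.2) (fun p => ⟨p.1 + p.2, p⟩) ?_ ?_ ?_ ?_ ?_
    · rintro ⟨j, p⟩ h
      simp only [mem_sigma, mem_range, HasAntidiagonal.mem_antidiagonal] at h
      simp only [mem_filter, mem_product, mem_range]
      omega
    · intro p h
      simp only [mem_filter, mem_product, mem_range] at h
      simp only [mem_sigma, mem_range, HasAntidiagonal.mem_antidiagonal]
      exact ⟨h.2, trivial⟩
    · rintro ⟨j, p⟩ h
      simp only [mem_sigma, mem_range, HasAntidiagonal.mem_antidiagonal] at h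
      obtain ⟨-, rfl⟩ := h
      rfl
    · intro p _
      rfl
    · rintro ⟨j, p⟩ h
      simp only [mem_sigma, mem_range, HasAntidiagonal.mem_antidiagonal] at h
      rw [← h.2]
      ring
  rw [h1, sum_mul_sum, ← sum_product',
    ← sum_filter_add_sum_filter_not _ (fun p : ℕ × ℕ => p.1 + p.2 < r + 1), add_sub_cancel_left]
  have hG0 : 0 ≤ G := by simpa using (norm_nonneg _).trans (hg 0 (Nat.zero_le _))
  calc _ ≤ ∑ p ∈ (range (r + 1) ×ˢ range (r + 1)) with ¬ p.1 + p.2 < r + 1,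
          F * G * (T * u) ^ (r + 1) := by
        refine norm_sum_le_of_le _ fun p hp => ?_
        simp only [mem_filter, mem_product, mem_range, not_lt] at hp
        have hv : 0 ≤ T * u := mul_nonneg hT hu
        calc _ = (‖PowerSeries.coeff p.1 f‖ * ‖PowerSeries.coeff p.2 g‖) * u ^ (p.1 + p.2) := by
              simp only [norm_mul, norm_pow, Complex.norm_real, Real.norm_of_nonneg hu]
              ring
          _ ≤ ((F * T ^ p.1) * (G * T ^ p.2)) * u ^ (p.1 + p.2) := by
              gcongr
              · exact hf _ (by omega)
              · exact hg _ (by omega)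
          _ = F * G * (T * u) ^ (p.1 + p.2) := by ring
          _ ≤ F * G * (T * u) ^ (r + 1) := by
              gcongr ?_ * ?_
              exact pow_le_pow_of_le_one hv hTu hp.2
    _ ≤ ∑ p ∈ (range (r + 1) ×ˢ range (r + 1)), F * G * (T * u) ^ (r + 1) :=
        sum_le_sum_of_subset_of_nonneg (filter_subset _ _) fun _ _ _ => by positivity
    _ = (r + 1) ^ 2 * (F * G) * (T * u) ^ (r + 1) := by
        simp only [sum_const, card_product, card_range, nsmul_eq_mul]
        push_cast
        ring

theorem norm_sum_coeff_le (hT : 0 ≤ T) (hu : 0 ≤ u) (hTu : T * u ≤ 1) {F : ℝ} (hF0 : 0 ≤ F)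
    {f : PowerSeries ℂ} (hf : ∀ j ≤ r, ‖PowerSeries.coeff j f‖ ≤ F * T ^ j) :
    ‖∑ j ∈ range (r + 1), PowerSeries.coeff j f * (u : ℂ) ^ j‖ ≤ (r + 1) * F := by
  calc _ ≤ ∑ j ∈ range (r + 1), F := by
        refine norm_sum_le_of_le _ fun j hj => ?_
        rw [norm_mul, norm_pow, Complex.norm_real, Real.norm_of_nonneg hu]
        calc _ ≤ F * T ^ j * u ^ j := by
              gcongr
              exact hf j (by simpa [Nat.lt_succ_iff] using hj)
          _ = F * (T * u) ^ j := by ring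
          _ ≤ F := mul_le_of_le_one_right hF0 (pow_le_one₀ (by positivity) hTu)
    _ = (r + 1) * F := by simp

/-- Taking powers commutes with truncation after degree `r` up to terms of degree `r + 1`. -/
theorem exists_norm_pow_sub_sum_coeff_pow_le (r d : ℕ) : ∃ C : ℝ, 0 ≤ C ∧
    ∀ (A : PowerSeries ℂ) (T u : ℝ) (w : ℂ), 0 ≤ T → 0 ≤ u → T * u ≤ 1 →
      (∀ j ≤ r, ‖PowerSeries.coeff j A‖ ≤ T ^ j) →
      ‖w - ∑ j ∈ range (r + 1), PowerSeries.coeff j A * (u : ℂ) ^ j‖ ≤ (T * u) ^ (r + 1) →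
      ‖w ^ d - ∑ j ∈ range (r + 1), PowerSeries.coeff j (A ^ d) * (u : ℂ) ^ j‖
        ≤ C * (T * u) ^ (r + 1) := by
  induction d with
  | zero =>
    refine ⟨0, le_rfl, fun A T u w _ _ _ _ _ => ?_⟩
    simp [PowerSeries.coeff_one]
  | succ d ih =>
    obtain ⟨C, hC, h⟩ := ih
    refine ⟨C * (r + 2) + (r + 1) ^ (d + 1) + (r + 1) ^ 2 * (r + 1) ^ d, by positivity,
      fun A T u w hT hu hTu hA hw => ?_⟩
    have hd := h A T u w hT hu hTu hA hw
    have hAd := norm_coeff_pow_le hT hA d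
    have hA1 : ∀ j ≤ r, ‖PowerSeries.coeff j A‖ ≤ 1 * T ^ j := by simpa using hA
    have hSd := norm_sum_coeff_le hT hu hTu (by positivity) hAd
    have hS1 := norm_sum_coeff_le hT hu hTu zero_le_one hA1
    have hmul := norm_mul_sub_sum_coeff_mul_le hT hu hTu (by positivity) hAd hA1
    rw [← pow_succ] at hmul
    set S1 := ∑ j ∈ range (r + 1), PowerSeries.coeff j A * (u : ℂ) ^ j
    set Sd := ∑ j ∈ range (r + 1), PowerSeries.coeff j (A ^ d) * (u : ℂ) ^ j
    set v := T * u
    have hv : 0 ≤ v := mul_nonneg hT hu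
    have hwn : ‖w‖ ≤ r + 2 := by
      calc ‖w‖ = ‖(w - S1) + S1‖ := by rw [sub_add_cancel]
        _ ≤ v ^ (r + 1) + (r + 1) * 1 := (norm_add_le _ _).trans (add_le_add hw hS1)
        _ ≤ 1 + (r + 1) * 1 := by gcongr; exact pow_le_one₀ hv hTu
        _ = r + 2 := by ring
    calc _ = ‖(w ^ d - Sd) * w + Sd * (w - S1) + (Sd * S1
          - ∑ j ∈ range (r + 1), PowerSeries.coeff j (A ^ (d + 1)) * (u : ℂ) ^ j)‖ := by
          congr 1; ring
      _ ≤ ‖w ^ d - Sd‖ * ‖w‖ + ‖Sd‖ * ‖w - S1‖ + ‖Sd * S1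
          - ∑ j ∈ range (r + 1), PowerSeries.coeff j (A ^ (d + 1)) * (u : ℂ) ^ j‖ := by
          refine (norm_add_le _ _).trans (add_le_add_left ((norm_add_le _ _).trans ?_) _)
          rw [norm_mul, norm_mul]
      _ ≤ (C * v ^ (r + 1)) * (r + 2) + ((r + 1) * (r + 1) ^ d) * v ^ (r + 1)
          + (r + 1) ^ 2 * ((r + 1) ^ d * 1) * v ^ (r + 1) := by gcongr
      _ = _ := by ring

theorem norm_expCoeff_le (hT : 0 ≤ T) {A : PowerSeries ℂ}
    (hA : ∀ j ≤ r, ‖PowerSeries.coeff j A‖ ≤ T ^ j) {j : ℕ} (hj : j ≤ r) :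
    ‖expCoeff A r j‖ ≤ (r + 1 : ℝ) ^ (r + 1) * T ^ j := by
  calc _ ≤ ∑ d ∈ range (r + 1), (r + 1 : ℝ) ^ r * T ^ j := by
        refine norm_sum_le_of_le _ fun d hd => ?_
        rw [norm_mul, norm_inv, Complex.norm_natCast]
        have h1 : ((d.factorial : ℝ))⁻¹ ≤ 1 :=
          inv_le_one_of_one_le₀ (by exact_mod_cast d.factorial_pos)
        have h2 : (r + 1 : ℝ) ^ d ≤ (r + 1 : ℝ) ^ r :=
          pow_le_pow_right₀ (by simp) (by simpa [Nat.lt_succ_iff] using hd)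
        calc _ ≤ 1 * ((r + 1 : ℝ) ^ d * T ^ j) := by
              gcongr
              exact norm_coeff_pow_le hT hA d j hj
          _ ≤ (r + 1 : ℝ) ^ r * T ^ j := by rw [one_mul]; gcongr
    _ = _ := by simp; ring

/-- If `w` is given by the power series `A` in `u` up to an error of degree `r + 1`, then so is
`exp w` by the formal exponential of `A`. The constant depends on `r` only. -/
theorem exists_norm_exp_sub_sum_expCoeff_le (r : ℕ) : ∃ C : ℝ, 0 ≤ C ∧
    ∀ (A : PowerSeries ℂ) (T u : ℝ) (w : ℂ), 0 ≤ T → 0 ≤ u → PowerSeries.coeff 0 A = 0 →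
      (∀ j ≤ r, ‖PowerSeries.coeff j A‖ ≤ T ^ j) →
      ‖w - ∑ j ∈ range (r + 1), PowerSeries.coeff j A * (u : ℂ) ^ j‖ ≤ (T * u) ^ (r + 1) →
      ‖Complex.exp w - ∑ j ∈ range (r + 1), expCoeff A r j * (u : ℂ) ^ j‖
        ≤ C * (T * u) ^ (r + 1) * Real.exp ‖w‖ := by
  choose C hC0 hC using exists_norm_pow_sub_sum_coeff_pow_le r
  have hsum0 : 0 ≤ ∑ d ∈ range (r + 1), C d := sum_nonneg fun d _ => hC0 d
  refine ⟨(r + 2) ^ (r + 1) + ∑ d ∈ range (r + 1), C d + (1 + (r + 1) * (r + 1) ^ (r + 1)),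
    by positivity, fun A T u w hT hu hA0 hA hw => ?_⟩
  -- `v = T * u` is the effective expansion parameter, as the `j`-th term of `A` is at most `v ^ j`
  set v := T * u
  have hv : 0 ≤ v := mul_nonneg hT hu
  have hexp1 : 1 ≤ Real.exp ‖w‖ := Real.one_le_exp (norm_nonneg _)
  rcases le_total v 1 with hv1 | hv1
  · have hwn : ‖w‖ ≤ (r + 2) * v := by
      calc ‖w‖ = ‖(w - ∑ j ∈ range (r + 1), PowerSeries.coeff j A * (u : ℂ) ^ j)
            + ∑ j ∈ range (r + 1), PowerSeries.coeff j A * (u : ℂ) ^ j‖ := by rw [sub_add_cancel]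
        _ ≤ v ^ (r + 1) + ∑ j ∈ range (r + 1), v := by
            refine (norm_add_le _ _).trans (add_le_add hw (norm_sum_le_of_le _ fun j hj => ?_))
            rcases Nat.eq_zero_or_pos j with rfl | hj0
            · simpa [hA0] using hv
            · rw [norm_mul, norm_pow, Complex.norm_real, Real.norm_of_nonneg hu]
              calc _ ≤ T ^ j * u ^ j := by
                    gcongr
                    exact hA j (by simpa [Nat.lt_succ_iff] using hj)
                _ = v ^ j := by rw [← mul_pow]
                _ ≤ v ^ 1 := pow_le_pow_of_le_one hv hv1 hj0
                _ = v := pow_one v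
        _ ≤ v ^ 1 + ∑ j ∈ range (r + 1), v := by
            gcongr ?_ + _
            exact pow_le_pow_of_le_one hv hv1 (by omega)
        _ = (r + 2) * v := by simp; ring
    have hswap : ∑ j ∈ range (r + 1), expCoeff A r j * (u : ℂ) ^ j
        = ∑ d ∈ range (r + 1), (d.factorial : ℂ)⁻¹
          * ∑ j ∈ range (r + 1), PowerSeries.coeff j (A ^ d) * (u : ℂ) ^ j := by
      simp_rw [expCoeff, sum_mul, mul_sum]
      rw [sum_comm]
      exact sum_congr rfl fun d _ => sum_congr rfl fun j _ => by ring
    have hsum : ‖∑ d ∈ range (r + 1), w ^ d / (d.factorial : ℂ)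
        - ∑ j ∈ range (r + 1), expCoeff A r j * (u : ℂ) ^ j‖
        ≤ (∑ d ∈ range (r + 1), C d) * v ^ (r + 1) := by
      rw [hswap, ← sum_sub_distrib, sum_mul]
      refine norm_sum_le_of_le _ fun d _ => ?_
      have h1 : ((d.factorial : ℝ))⁻¹ ≤ 1 :=
        inv_le_one_of_one_le₀ (by exact_mod_cast d.factorial_pos)
      rw [div_eq_inv_mul, ← mul_sub, norm_mul, norm_inv, Complex.norm_natCast]
      calc _ ≤ 1 * (C d * v ^ (r + 1)) := by
            gcongr
            exact hC d A T u w hT hu hv1 hA hw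
        _ = C d * v ^ (r + 1) := one_mul _
    calc _ = ‖(Complex.exp w - ∑ d ∈ range (r + 1), w ^ d / (d.factorial : ℂ))
          + (∑ d ∈ range (r + 1), w ^ d / (d.factorial : ℂ)
            - ∑ j ∈ range (r + 1), expCoeff A r j * (u : ℂ) ^ j)‖ := by rw [sub_add_sub_cancel]
      _ ≤ ‖w‖ ^ (r + 1) * Real.exp ‖w‖ + (∑ d ∈ range (r + 1), C d) * v ^ (r + 1) :=
          (norm_add_le _ _).trans
            (add_le_add (Complex.norm_exp_sub_sum_le_norm_mul_exp w (r + 1)) hsum)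
      _ ≤ ((r + 2) * v) ^ (r + 1) * Real.exp ‖w‖
          + (∑ d ∈ range (r + 1), C d) * v ^ (r + 1) * Real.exp ‖w‖ := by
          refine add_le_add ?_ (le_mul_of_one_le_right (by positivity) hexp1)
          gcongr
      _ = ((r + 2) ^ (r + 1) + ∑ d ∈ range (r + 1), C d) * v ^ (r + 1) * Real.exp ‖w‖ := by
          rw [mul_pow]; ring
      _ ≤ _ := by
          gcongr ?_ * _ * _
          exact le_add_of_nonneg_right (by positivity)
  -- for `v ≥ 1` every term is at most a constant times `v ^ (r + 1) * exp ‖w‖`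
  · have h1 : 1 ≤ v ^ (r + 1) := one_le_pow₀ hv1
    calc _ ≤ ‖Complex.exp w‖ + ‖∑ j ∈ range (r + 1), expCoeff A r j * (u : ℂ) ^ j‖ :=
          norm_sub_le _ _
      _ ≤ 1 * v ^ (r + 1) * Real.exp ‖w‖
          + ∑ j ∈ range (r + 1), (r + 1) ^ (r + 1) * v ^ (r + 1) * Real.exp ‖w‖ := by
          refine add_le_add ?_ (norm_sum_le_of_le _ fun j hj => ?_)
          · refine (Complex.norm_exp_le_exp_norm w).trans ?_
            rw [one_mul]
            exact le_mul_of_one_le_left (Real.exp_pos _).le h1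
          · have hj' : j ≤ r := by simpa [Nat.lt_succ_iff] using hj
            rw [norm_mul, norm_pow, Complex.norm_real, Real.norm_of_nonneg hu]
            calc _ ≤ (r + 1 : ℝ) ^ (r + 1) * T ^ j * u ^ j := by
                  gcongr
                  exact norm_expCoeff_le hT hA hj'
              _ = (r + 1 : ℝ) ^ (r + 1) * v ^ j := by rw [mul_pow]; ring
              _ ≤ (r + 1 : ℝ) ^ (r + 1) * v ^ (r + 1) := by
                  gcongr ?_ * ?_
                  exact pow_le_pow_right₀ hv1 (by omega)
              _ ≤ _ := le_mul_of_one_le_right (by positivity) hexp1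
      _ = (1 + (r + 1) * (r + 1) ^ (r + 1)) * v ^ (r + 1) * Real.exp ‖w‖ := by simp; ring
      _ ≤ _ := by
          gcongr ?_ * _ * _
          exact le_add_of_nonneg_left (by positivity)

/-- The series `∑_{j ≥ 1} κ_{j+2} / (j+2)! z^{j+2} u^j` in `u`, for a complex number `z`. -/
noncomputable def edgeworthSeries (κ : ℕ → ℝ) (z : ℂ) : PowerSeries ℂ :=
  PowerSeries.mk fun j =>
    if j = 0 then 0 else (κ (j + 2) / (Nat.factorial (j + 2) : ℝ) : ℝ) * z ^ (j + 2)

theorem map_edgeworthExponent (κ : ℕ → ℝ) (z : ℂ) :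
    PowerSeries.map (Polynomial.aeval z : ℝ[X] →ₐ[ℝ] ℂ).toRingHom (edgeworthExponent κ)
      = edgeworthSeries κ z := by
  ext j
  rw [PowerSeries.coeff_map, edgeworthExponent, edgeworthSeries, PowerSeries.coeff_mk,
    PowerSeries.coeff_mk]
  split_ifs
  · simp
  · simp [Polynomial.aeval_monomial]

theorem aeval_edgeworthP (κ : ℕ → ℝ) (z : ℂ) {j r : ℕ} (hj : j ≤ r) :
    Polynomial.aeval z (edgeworthP κ j) = expCoeff (edgeworthSeries κ z) r j := by
  have h0 : PowerSeries.constantCoeff (edgeworthExponent κ) = 0 := by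
    simp [edgeworthExponent]
  have hX : (PowerSeries.X : PowerSeries ℝ[X]) ∣ edgeworthExponent κ := PowerSeries.X_dvd_iff.2 h0
  rw [edgeworthP, PowerSeries.coeff_subst' (PowerSeries.HasSubst.of_constantCoeff_zero' h0),
    finsum_eq_sum_of_support_subset (s := range (r + 1)), map_sum, expCoeff]
  · refine sum_congr rfl fun d _ => ?_
    rw [PowerSeries.coeff_exp, smul_eq_mul, map_mul, ← map_edgeworthExponent, ← map_pow,
      PowerSeries.coeff_map]
    congr 1
    rw [← (Polynomial.aeval z : ℝ[X] →ₐ[ℝ] ℂ).coe_toRingHom]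
    simp
  · intro d hd
    by_contra hdr
    simp only [coe_range, Set.mem_Iio, not_lt] at hdr
    refine hd ?_
    simp only
    rw [PowerSeries.X_pow_dvd_iff.1 (pow_dvd_pow_of_dvd hX d) j (by omega), smul_zero]

end FormalExp

/-! ### The logarithm of the generating function near the real axis -/

section Taylor

open Finset Filter Topology

/-- Taylor's theorem with a remainder that is uniform in the centre and the argument. -/
theorem norm_sub_taylor_le {s : Set ℂ} (hs : Convex ℝ s) (N : ℕ) {C : ℝ} {L : ℂ → ℂ}
    (hL : ∀ z ∈ s, AnalyticAt ℂ L z) (hC : ∀ z ∈ s, ‖iteratedDeriv N L z‖ ≤ C) {w z : ℂ}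
    (hw : w ∈ s) (hz : z ∈ s) :
    ‖L z - ∑ j ∈ range N, iteratedDeriv j L w / (j.factorial : ℂ) * (z - w) ^ j‖
      ≤ C * ‖z - w‖ ^ N := by
  induction N generalizing L z with
  | zero => simpa using hC z hz
  | succ N ih =>
    have hC0 : 0 ≤ C := (norm_nonneg _).trans (hC w hw)
    have hseg : segment ℝ w z ⊆ s := hs.segment_subset hw hz
    -- the derivative `R'` of the remainder `R` is the remainder of lower order for `deriv L`
    set R : ℂ → ℂ := fun x =>
      L x - ∑ j ∈ range (N + 1), iteratedDeriv j L w / (j.factorial : ℂ) * (x - w) ^ j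
    set R' : ℂ → ℂ := fun x =>
      deriv L x - ∑ j ∈ range N, iteratedDeriv j (deriv L) w / (j.factorial : ℂ) * (x - w) ^ j
    have hR : ∀ x ∈ segment ℝ w z, HasDerivWithinAt R (R' x) (segment ℝ w z) x := by
      intro x hx
      refine HasDerivAt.hasDerivWithinAt ?_
      refine (hL x (hseg hx)).differentiableAt.hasDerivAt.sub ?_
      have h1 : ∀ j ∈ range (N + 1), HasDerivAt
          (fun x => iteratedDeriv j L w / (j.factorial : ℂ) * (x - w) ^ j)
          (iteratedDeriv j L w / (j.factorial : ℂ) * (j * (x - w) ^ (j - 1))) x := by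
        intro j _
        have := (((hasDerivAt_id x).sub_const w).pow j).const_mul
          (iteratedDeriv j L w / (j.factorial : ℂ))
        simpa using this
      have h2 := HasDerivAt.fun_sum h1
      rw [sum_range_succ'] at h2
      refine h2.congr_deriv ?_
      simp only [Nat.cast_zero, zero_mul, mul_zero, add_zero, Nat.add_sub_cancel,
        ← iteratedDeriv_succ']
      refine sum_congr rfl fun j _ => ?_
      rw [Nat.factorial_succ]
      have : (j.factorial : ℂ) ≠ 0 := by exact_mod_cast j.factorial_ne_zero
      have : (j : ℂ) + 1 ≠ 0 := by exact_mod_cast j.succ_ne_zero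
      push_cast
      field_simp
    have hbound : ∀ x ∈ segment ℝ w z, ‖R' x‖ ≤ C * ‖z - w‖ ^ N := by
      intro x hx
      have h1 := ih (fun y hy => (hL y hy).deriv)
        (fun y hy => by rw [← iteratedDeriv_succ']; exact hC y hy) (hseg hx)
      refine h1.trans ?_
      gcongr
      obtain ⟨a, b, ha, hb, hab, rfl⟩ := hx
      have : a • w + b • z - w = b • (z - w) := by
        rw [← eq_sub_iff_add_eq] at hab
        rw [hab]
        simp only [Complex.real_smul]
        push_cast
        ring
      rw [this, norm_smul, Real.norm_of_nonneg hb]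
      exact mul_le_of_le_one_left (norm_nonneg _) (by linarith)
    have h := (convex_segment w z).norm_image_sub_le_of_norm_hasDerivWithin_le hR hbound
      (left_mem_segment ℝ w z) (right_mem_segment ℝ w z)
    have hRw : R w = L w - L w := by
      simp only [R, sum_range_succ', sub_self]
      simp
    rw [hRw, sub_self, sub_zero] at h
    calc _ ≤ C * ‖z - w‖ ^ N * ‖z - w‖ := h
      _ = _ := by ring

/-- The derivatives of an analytic function that is real on the real axis are the derivatives of its
restriction. -/
theorem iteratedDeriv_ofReal_eq {L : ℂ → ℂ} {ψ : ℝ → ℝ} {U : Set ℝ} (hU : IsOpen U)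
    (hL : ∀ x ∈ U, AnalyticAt ℂ L x) (h : ∀ x ∈ U, L x = ψ x) (j : ℕ) :
    ∀ x ∈ U, iteratedDeriv j L x = (iteratedDeriv j ψ x : ℝ) := by
  induction j with
  | zero => simpa using h
  | succ j ih =>
    intro x hx
    have hA : AnalyticAt ℂ (iteratedDeriv j L) x := by
      rw [iteratedDeriv_eq_iterate]
      exact (hL x hx).iterated_deriv j
    have h1 := hA.differentiableAt.hasDerivAt
    rw [← iteratedDeriv_succ] at h1
    have hev : ∀ᶠ y : ℝ in 𝓝 x, iteratedDeriv j L (y : ℂ) = (iteratedDeriv j ψ y : ℝ) :=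
      eventually_of_mem (hU.mem_nhds hx) ih
    have h2 : HasDerivAt (iteratedDeriv j ψ) (iteratedDeriv (j + 1) L x).re x :=
      h1.real_of_complex.congr_of_eventuallyEq (hev.mono fun y hy => by
        simp only [hy, Complex.ofReal_re])
    have h3 : HasDerivAt (fun y : ℝ => ((iteratedDeriv j ψ y : ℝ) : ℂ))
        (iteratedDeriv (j + 1) L x) x :=
      h1.comp_ofReal.congr_of_eventuallyEq (hev.mono fun y hy => hy.symm)
    rw [h3.unique h2.ofReal_comp, iteratedDeriv_succ (f := ψ), h2.deriv]

/-- Uniform Taylor expansion, in the imaginary direction, of the logarithm of a function that is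
analytic near a compact set of reals, where it is positive. -/
theorem exists_norm_log_sub_taylor_le {M : ℂ → ℂ} {ψ : ℝ → ℝ} {D K : Set ℝ} (hD : IsOpen D)
    (hM : ∀ x ∈ D, AnalyticAt ℂ M x) (hψ : ∀ x ∈ D, M x = (Real.exp (ψ x) : ℝ)) (hK : IsCompact K)
    (hKD : K ⊆ D) (N : ℕ) :
    ∃ δ > 0, ∃ C : ℝ, ∀ β ∈ K, ∀ t : ℝ, |t| ≤ δ → M (β + t * Complex.I) ≠ 0 ∧
      ‖Complex.log (M (β + t * Complex.I)) - ∑ j ∈ range N,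
        ((iteratedDeriv j ψ β / (j.factorial : ℝ) : ℝ) : ℂ) * (t * Complex.I) ^ j‖
        ≤ C * |t| ^ N := by
  refine hK.induction_on (p := fun S => ∃ δ > 0, ∃ C : ℝ, ∀ β ∈ S, ∀ t : ℝ, |t| ≤ δ →
    M (β + t * Complex.I) ≠ 0 ∧ ‖Complex.log (M (β + t * Complex.I)) - ∑ j ∈ range N,
      ((iteratedDeriv j ψ β / (j.factorial : ℝ) : ℝ) : ℂ) * (t * Complex.I) ^ j‖ ≤ C * |t| ^ N)
    ⟨1, one_pos, 0, by simp⟩ ?_ ?_ ?_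
  · rintro S S' hSS ⟨δ, hδ, C, h⟩
    exact ⟨δ, hδ, C, fun β hβ => h β (hSS hβ)⟩
  · rintro S S' ⟨δ, hδ, C, h⟩ ⟨δ', hδ', C', h'⟩
    refine ⟨min δ δ', lt_min hδ hδ', max C C', fun β hβ t ht => ?_⟩
    rcases hβ with hβ | hβ
    · refine (h β hβ t (ht.trans (min_le_left _ _))).imp_right fun h => h.trans ?_
      gcongr
      exact le_max_left _ _
    · refine (h' β hβ t (ht.trans (min_le_right _ _))).imp_right fun h => h.trans ?_
      gcongr
      exact le_max_right _ _
  · intro b hb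
    set L : ℂ → ℂ := fun z => Complex.log (M z)
    have hbD := hKD hb
    have hslit : ∀ x ∈ D, M x ∈ Complex.slitPlane := fun x hx => by
      rw [hψ x hx]
      exact Complex.ofReal_mem_slitPlane.2 (Real.exp_pos _)
    have hLan : ∀ x ∈ D, AnalyticAt ℂ L x := fun x hx => (hM x hx).clog (hslit x hx)
    have hLψ : ∀ x ∈ D, L x = ψ x := fun x hx => by
      simp only [L, hψ x hx]
      rw [← Complex.ofReal_log (Real.exp_pos _).le, Real.log_exp]
    have hder := iteratedDeriv_ofReal_eq hD hLan hLψ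
    have hcont : ContinuousAt (iteratedDeriv N L) b := by
      rw [iteratedDeriv_eq_iterate]
      exact ((hLan b hbD).iterated_deriv N).continuousAt
    have hbdd : ∀ᶠ z in 𝓝 (b : ℂ), ‖iteratedDeriv N L z‖ ≤ ‖iteratedDeriv N L b‖ + 1 :=
      (hcont.norm.eventually_lt_const (lt_add_one _)).mono fun _ h => h.le
    have hne : ∀ᶠ z in 𝓝 (b : ℂ), M z ∈ Complex.slitPlane :=
      (hM b hbD).continuousAt.eventually_mem (Complex.isOpen_slitPlane.mem_nhds (hslit b hbD))
    obtain ⟨ρ, hρ, hball⟩ := Metric.eventually_nhds_iff_ball.1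
      (((hLan b hbD).eventually_analyticAt.and hbdd).and hne)
    refine ⟨D ∩ Metric.ball b (ρ / 2), mem_nhdsWithin_of_mem_nhds
      (inter_mem (hD.mem_nhds hbD) (Metric.ball_mem_nhds b (by positivity))),
      ρ / 3, by positivity, ‖iteratedDeriv N L b‖ + 1, fun β hβ t ht => ?_⟩
    have hβb : dist (β : ℂ) b < ρ / 2 := by
      rw [Complex.dist_eq, ← Complex.ofReal_sub, Complex.norm_real]
      exact hβ.2
    have hw : (β : ℂ) ∈ Metric.ball (b : ℂ) ρ := by
      rw [Metric.mem_ball]; linarith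
    have hz : (β + t * Complex.I : ℂ) ∈ Metric.ball (b : ℂ) ρ := by
      rw [Metric.mem_ball]
      have h1 : dist (β + t * Complex.I : ℂ) β = |t| := by
        rw [Complex.dist_eq]; simp
      linarith [dist_triangle (β + t * Complex.I : ℂ) β b]
    refine ⟨Complex.slitPlane_ne_zero (hball _ hz).2, ?_⟩
    have h := norm_sub_taylor_le (convex_ball (b : ℂ) ρ) N (fun z hz => (hball z hz).1.1)
      (fun z hz => (hball z hz).1.2) hw hz
    have h1 : ‖(t * Complex.I : ℂ)‖ = |t| := by simp
    simp only [add_sub_cancel_left, h1] at h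
    convert h using 4 with j
    rw [hder j β hβ.1]
    push_cast
    rfl

end Taylor

/-! ### The Edgeworth expansion of the characteristic function -/

section Pointwise

open Finset

/-- The Edgeworth approximation of order `r` of the `n`-th power of the characteristic function
with cumulants `κ`. -/
noncomputable def edgeworthChar (κ : ℕ → ℝ) (r n : ℕ) (t : ℝ) : ℂ :=
  Complex.exp (n * (κ 1 * (t * Complex.I) - κ 2 * t ^ 2 / 2)) *
    ∑ j ∈ range (r + 1), Polynomial.aeval (Real.sqrt n * (t * Complex.I) : ℂ) (edgeworthP κ j)
      * (((Real.sqrt n)⁻¹ : ℝ) : ℂ) ^ j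

/-- The `j`-th coefficient has degree `j + 2 ≤ 3 * j` in `z`, hence the cube. -/
theorem norm_coeff_edgeworthSeries_le {κ : ℕ → ℝ} {B : ℝ} (hB : 1 ≤ B) {r : ℕ}
    (hκ : ∀ j ≤ r, |κ (j + 2) / ((j + 2).factorial : ℝ)| ≤ B) (z : ℂ) {j : ℕ} (hj : j ≤ r) :
    ‖PowerSeries.coeff j (edgeworthSeries κ z)‖ ≤ (B * (1 + ‖z‖) ^ 3) ^ j := by
  rw [edgeworthSeries, PowerSeries.coeff_mk]
  split_ifs with h0
  · simp [h0]
  · have h1 : (1 : ℝ) ≤ 1 + ‖z‖ := by linarith [norm_nonneg z]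
    rw [norm_mul, norm_pow, Complex.norm_real, Real.norm_eq_abs, mul_pow, ← pow_mul]
    gcongr ?_ * ?_
    · exact (hκ j hj).trans (le_self_pow₀ hB h0)
    · calc ‖z‖ ^ (j + 2) ≤ (1 + ‖z‖) ^ (j + 2) := by gcongr; linarith
        _ ≤ (1 + ‖z‖) ^ (3 * j) := pow_le_pow_right₀ h1 (by omega)

theorem norm_exp_gaussian (n : ℕ) (a b t : ℝ) :
    ‖Complex.exp (n * (a * (t * Complex.I) - b * t ^ 2 / 2))‖ = Real.exp (-(n * b * t ^ 2 / 2)) := by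
  rw [Complex.norm_exp]
  congr 1
  have : (n * (a * (t * Complex.I) - b * t ^ 2 / 2) : ℂ)
      = ((-(n * b * t ^ 2 / 2) : ℝ) : ℂ) + ((n * a * t : ℝ) : ℂ) * Complex.I := by
    push_cast; ring
  rw [this, Complex.add_re, Complex.ofReal_re, Complex.re_ofReal_mul, Complex.I_re, mul_zero,
    add_zero]

/-- The Taylor expansion of the cumulant generating function gives the Edgeworth expansion of the
characteristic function, with a Gaussian factor left in the error. -/
theorem exists_norm_exp_sub_edgeworthChar_le (r : ℕ) : ∃ C : ℝ, 0 ≤ C ∧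
    ∀ (κ : ℕ → ℝ) (B : ℝ) (n : ℕ) (t : ℝ) (l : ℂ), 1 ≤ B → 1 ≤ n →
      (∀ j ≤ r, |κ (j + 2) / ((j + 2).factorial : ℝ)| ≤ B) →
      ‖l - ∑ j ∈ range 3, ((κ j / (j.factorial : ℝ) : ℝ) : ℂ) * (t * Complex.I) ^ j‖
        ≤ κ 2 * t ^ 2 / 4 →
      ‖l - ∑ j ∈ range (r + 3), ((κ j / (j.factorial : ℝ) : ℝ) : ℂ) * (t * Complex.I) ^ j‖
        ≤ B * |t| ^ (r + 3) →
      ‖Complex.exp (n * (l - κ 0)) - edgeworthChar κ r n t‖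
        ≤ C * (B * (1 + Real.sqrt n * |t|) ^ 3 * (Real.sqrt n)⁻¹) ^ (r + 1)
          * Real.exp (-(n * κ 2 * t ^ 2 / 4)) := by
  obtain ⟨C, hC0, hC⟩ := exists_norm_exp_sub_sum_expCoeff_le r
  refine ⟨C, hC0, fun κ B n t l hB hn hκ h3 hr => ?_⟩
  have hn' : (0 : ℝ) < n := by exact_mod_cast hn
  set q := Real.sqrt n
  have hq : 0 < q := Real.sqrt_pos.2 hn'
  have hq2 : (q : ℂ) ^ 2 = n := by
    rw [← Complex.ofReal_pow, Real.sq_sqrt hn'.le]; simp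
  have hqne : (q : ℂ) ≠ 0 := by exact_mod_cast hq.ne'
  set z : ℂ := q * (t * Complex.I)
  have hz : ‖z‖ = q * |t| := by simp [z, abs_of_pos hq]
  set T := B * (1 + q * |t|) ^ 3
  have hT : 0 ≤ T := by positivity
  set S3 := ∑ j ∈ range 3, ((κ j / (j.factorial : ℝ) : ℝ) : ℂ) * (t * Complex.I) ^ j
  -- `w` is what is left of the exponent after the Gaussian part has been split off
  set w : ℂ := n * (l - S3)
  have hS3 : S3 = κ 0 + (κ 1 * (t * Complex.I) - κ 2 * t ^ 2 / 2) := by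
    simp only [S3, sum_range_succ, range_zero, sum_empty, Nat.factorial]
    have : (t * Complex.I) ^ 2 = (-(t ^ 2) : ℂ) := by rw [mul_pow, Complex.I_sq]; ring
    rw [this]
    push_cast
    ring
  have hw : ‖w‖ ≤ n * κ 2 * t ^ 2 / 4 := by
    rw [norm_mul, Complex.norm_natCast]
    calc (n : ℝ) * ‖l - S3‖ ≤ n * (κ 2 * t ^ 2 / 4) := by gcongr
      _ = _ := by ring
  have hcoef (j : ℕ) (hj : j ≤ r) : ‖PowerSeries.coeff j (edgeworthSeries κ z)‖ ≤ T ^ j := by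
    have := norm_coeff_edgeworthSeries_le hB hκ z hj
    rwa [hz] at this
  have hsum : w - ∑ j ∈ range (r + 1),
      PowerSeries.coeff j (edgeworthSeries κ z) * ((q⁻¹ : ℝ) : ℂ) ^ j
      = n * (l - ∑ j ∈ range (r + 3), ((κ j / (j.factorial : ℝ) : ℝ) : ℂ)
        * (t * Complex.I) ^ j) := by
    have h1 : ∑ j ∈ range (r + 1),
        PowerSeries.coeff j (edgeworthSeries κ z) * ((q⁻¹ : ℝ) : ℂ) ^ j
        = n * ∑ j ∈ range r, ((κ (3 + j) / ((3 + j).factorial : ℝ) : ℝ) : ℂ)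
          * (t * Complex.I) ^ (3 + j) := by
      rw [sum_range_succ', mul_sum]
      simp only [edgeworthSeries, PowerSeries.coeff_mk, if_pos, zero_mul, add_zero]
      refine sum_congr rfl fun j _ => ?_
      rw [if_neg (Nat.succ_ne_zero j), show j + 1 + 2 = 3 + j by ring, ← hq2]
      simp only [z, Complex.ofReal_inv, inv_pow]
      field_simp
      ring
    rw [h1, add_comm r 3, sum_range_add, ← sub_sub, mul_sub]
  have hrem : ‖w - ∑ j ∈ range (r + 1),
      PowerSeries.coeff j (edgeworthSeries κ z) * ((q⁻¹ : ℝ) : ℂ) ^ j‖ ≤ (T * q⁻¹) ^ (r + 1) := by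
    rw [hsum, norm_mul, Complex.norm_natCast]
    calc (n : ℝ) * _ ≤ n * (B * |t| ^ (r + 3)) := by gcongr
      _ = B * (q * |t|) ^ (r + 3) * q⁻¹ ^ (r + 1) := by
          have : (n : ℝ) = q ^ 2 := (Real.sq_sqrt hn'.le).symm
          have h1 : q ^ (r + 1) * q⁻¹ ^ (r + 1) = 1 := by
            rw [← mul_pow, mul_inv_cancel₀ hq.ne', one_pow]
          calc _ = B * |t| ^ (r + 3) * q ^ 2 * 1 := by rw [this]; ring
            _ = _ := by rw [← h1]; ring
      _ ≤ B ^ (r + 1) * ((1 + q * |t|) ^ 3) ^ (r + 1) * q⁻¹ ^ (r + 1) := by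
          have hpos : 0 ≤ q * |t| := by positivity
          gcongr ?_ * ?_ * _
          · exact le_self_pow₀ hB (Nat.succ_ne_zero r)
          · rw [← pow_mul]
            calc (q * |t|) ^ (r + 3) ≤ (1 + q * |t|) ^ (r + 3) := by gcongr; linarith
              _ ≤ (1 + q * |t|) ^ (3 * (r + 1)) := pow_le_pow_right₀ (by linarith) (by omega)
      _ = (T * q⁻¹) ^ (r + 1) := by simp only [T]; rw [mul_pow, mul_pow]
  have hmain := hC (edgeworthSeries κ z) T q⁻¹ w hT (by positivity)
    (by simp [edgeworthSeries]) hcoef hrem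
  have hexp : Complex.exp (n * (l - κ 0))
      = Complex.exp (n * (κ 1 * (t * Complex.I) - κ 2 * t ^ 2 / 2)) * Complex.exp w := by
    rw [← Complex.exp_add]
    congr 1
    simp only [w, hS3]
    ring
  have hchar : edgeworthChar κ r n t
      = Complex.exp (n * (κ 1 * (t * Complex.I) - κ 2 * t ^ 2 / 2))
        * ∑ j ∈ range (r + 1), expCoeff (edgeworthSeries κ z) r j * ((q⁻¹ : ℝ) : ℂ) ^ j := by
    rw [edgeworthChar]
    congr 1
    refine sum_congr rfl fun j hj => ?_
    rw [aeval_edgeworthP κ _ (Nat.lt_succ_iff.1 (mem_range.1 hj))]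
  rw [hexp, hchar, ← mul_sub, norm_mul, norm_exp_gaussian]
  calc _ ≤ Real.exp (-(n * κ 2 * t ^ 2 / 2))
        * (C * (T * q⁻¹) ^ (r + 1) * Real.exp (n * κ 2 * t ^ 2 / 4)) := by
        gcongr
        exact hmain.trans (by gcongr)
    _ = C * (T * q⁻¹) ^ (r + 1)
        * (Real.exp (-(n * κ 2 * t ^ 2 / 2)) * Real.exp (n * κ 2 * t ^ 2 / 4)) := by ring
    _ = _ := by
        rw [← Real.exp_add]
        congr 2
        ring

theorem norm_edgeworthChar_le {κ : ℕ → ℝ} {B : ℝ} (hB : 1 ≤ B) {r : ℕ}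
    (hκ : ∀ j ≤ r, |κ (j + 2) / ((j + 2).factorial : ℝ)| ≤ B) {n : ℕ} (hn : 1 ≤ n) (t : ℝ) :
    ‖edgeworthChar κ r n t‖ ≤ (r + 1) ^ (r + 2) * (B * (1 + Real.sqrt n * |t|) ^ 3) ^ r
      * Real.exp (-(n * κ 2 * t ^ 2 / 2)) := by
  have hq : 1 ≤ Real.sqrt n := Real.one_le_sqrt.2 (by exact_mod_cast hn)
  set q := Real.sqrt n
  have hz : ‖(q * (t * Complex.I) : ℂ)‖ = q * |t| := by
    simp [abs_of_nonneg (zero_le_one.trans hq)]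
  set T := B * (1 + q * |t|) ^ 3
  have hT : 1 ≤ T := by
    have h1 : 1 ≤ 1 + q * |t| := by
      have : 0 ≤ q * |t| := by positivity
      linarith
    exact one_le_mul_of_one_le_of_one_le hB (one_le_pow₀ h1)
  have hcoef (j : ℕ) (hj : j ≤ r) :
      ‖PowerSeries.coeff j (edgeworthSeries κ (q * (t * Complex.I)))‖ ≤ T ^ j := by
    have := norm_coeff_edgeworthSeries_le hB hκ (q * (t * Complex.I)) hj
    rwa [hz] at this
  rw [edgeworthChar, norm_mul, norm_exp_gaussian, mul_comm]
  gcongr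
  calc _ ≤ ∑ j ∈ range (r + 1), (r + 1 : ℝ) ^ (r + 1) * T ^ r := by
        refine norm_sum_le_of_le _ fun j hj => ?_
        have hj' : j ≤ r := Nat.lt_succ_iff.1 (mem_range.1 hj)
        rw [aeval_edgeworthP κ _ hj', norm_mul, norm_pow, Complex.norm_real,
          Real.norm_of_nonneg (by positivity)]
        have h1 : q⁻¹ ^ j ≤ 1 := pow_le_one₀ (by positivity) (inv_le_one_of_one_le₀ hq)
        calc _ ≤ (r + 1 : ℝ) ^ (r + 1) * T ^ j * 1 := by
              gcongr
              exact norm_expCoeff_le (by positivity) hcoef hj'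
          _ ≤ (r + 1 : ℝ) ^ (r + 1) * T ^ r := by
              rw [mul_one]
              gcongr
    _ = _ := by simp; ring

end Pointwise

/-! ### Fourier transforms of Gaussians times polynomials -/

section Gaussian

theorem integrable_abs_pow_mul_exp_neg_mul_sq {b : ℝ} (hb : 0 < b) (m : ℕ) :
    Integrable fun y : ℝ => |y| ^ m * Real.exp (-b * y ^ 2) := by
  have h := (integrable_rpow_mul_exp_neg_mul_sq hb (s := m)
    (lt_of_lt_of_le (by norm_num) (Nat.cast_nonneg m))).norm
  refine h.congr (Filter.Eventually.of_forall fun y => ?_)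
  simp [Real.rpow_natCast]

theorem integrable_one_add_abs_pow_mul_exp_neg_mul_sq {b : ℝ} (hb : 0 < b) (m : ℕ) :
    Integrable fun y : ℝ => (1 + |y|) ^ m * Real.exp (-b * y ^ 2) := by
  have h := ((integrable_abs_pow_mul_exp_neg_mul_sq hb 0).add
    (integrable_abs_pow_mul_exp_neg_mul_sq hb m)).const_mul (2 ^ (m - 1))
  refine h.mono' (Continuous.aestronglyMeasurable (by fun_prop))
    (Filter.Eventually.of_forall fun y => ?_)
  rw [Real.norm_of_nonneg (by positivity)]
  have := add_pow_le zero_le_one (abs_nonneg y) m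
  simp only [Pi.add_apply, pow_zero, one_mul]
  rw [one_pow] at this
  calc _ ≤ (2 ^ (m - 1) * (1 + |y| ^ m)) * Real.exp (-b * y ^ 2) := by gcongr
    _ = _ := by ring

/-- The integrand of the Fourier integral of `(is)^l e^{-s²/2}`. -/
noncomputable def gaussianMoment (l : ℕ) (x s : ℝ) : ℂ :=
  Complex.exp (-(s * x * Complex.I)) * ((s * Complex.I) ^ l * (Real.exp (-(1 / 2) * s ^ 2) : ℝ))

theorem norm_gaussianMoment (l : ℕ) (x s : ℝ) :
    ‖gaussianMoment l x s‖ = |s| ^ l * Real.exp (-(1 / 2) * s ^ 2) := by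
  have : (-(s * x * Complex.I) : ℂ) = ((-(s * x) : ℝ) : ℂ) * Complex.I := by push_cast; ring
  rw [gaussianMoment, norm_mul, this, Complex.norm_exp_ofReal_mul_I, one_mul, norm_mul, norm_pow,
    norm_mul, Complex.norm_I, mul_one, Complex.norm_real, Complex.norm_real, Real.norm_eq_abs,
    Real.norm_of_nonneg (Real.exp_pos _).le]

theorem continuous_gaussianMoment (l : ℕ) (x : ℝ) : Continuous (gaussianMoment l x) := by
  unfold gaussianMoment
  fun_prop

theorem integrable_gaussianMoment (l : ℕ) (x : ℝ) : Integrable (gaussianMoment l x) :=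
  (integrable_abs_pow_mul_exp_neg_mul_sq (by norm_num : (0 : ℝ) < 1 / 2) l).mono'
    (continuous_gaussianMoment l x).aestronglyMeasurable
    (Filter.Eventually.of_forall fun s => (norm_gaussianMoment l x s).le)

theorem hasDerivAt_integral_gaussianMoment (l : ℕ) (x : ℝ) :
    HasDerivAt (fun x => ∫ s, gaussianMoment l x s) (-∫ s, gaussianMoment (l + 1) x s) x := by
  rw [← integral_neg]
  refine (hasDerivAt_integral_of_dominated_loc_of_deriv_le
    (bound := fun s => |s| ^ (l + 1) * Real.exp (-(1 / 2) * s ^ 2))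
    (F' := fun x s => -gaussianMoment (l + 1) x s) (s := Set.univ) Filter.univ_mem ?_ ?_ ?_ ?_ ?_ ?_).2
  · exact Filter.Eventually.of_forall fun x => (continuous_gaussianMoment l x).aestronglyMeasurable
  · exact integrable_gaussianMoment l x
  · exact (continuous_gaussianMoment (l + 1) x).neg.aestronglyMeasurable
  · exact Filter.Eventually.of_forall fun s x _ => by
      rw [norm_neg, norm_gaussianMoment]
  · exact integrable_abs_pow_mul_exp_neg_mul_sq (by norm_num : (0 : ℝ) < 1 / 2) (l + 1)
  · refine Filter.Eventually.of_forall fun s x _ => ?_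
    have h1 : HasDerivAt (fun x : ℝ => (-(s * x * Complex.I) : ℂ)) (-(s * 1 * Complex.I)) x :=
      (((Complex.ofRealCLM.hasDerivAt (x := x)).const_mul (s : ℂ)).mul_const Complex.I).neg
    have h2 := h1.cexp.mul_const ((s * Complex.I) ^ l * (Real.exp (-(1 / 2) * s ^ 2) : ℝ))
    refine h2.congr_deriv ?_
    simp only [gaussianMoment]
    ring

theorem integral_gaussianMoment_zero (x : ℝ) :
    ∫ s, gaussianMoment 0 x s = (Real.sqrt (2 * Real.pi) * Real.exp (-(x ^ 2 / 2)) : ℝ) := by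
  have h := fourierIntegral_gaussian (b := 1 / 2) (by norm_num) (-x)
  have h1 : (fun s : ℝ => gaussianMoment 0 x s) = fun s : ℝ =>
      Complex.exp (Complex.I * (-x : ℂ) * s) * Complex.exp (-(1 / 2 : ℂ) * s ^ 2) := by
    ext s
    rw [gaussianMoment, pow_zero, one_mul]
    push_cast
    ring_nf
  rw [h1, h]
  have h2 : (Real.pi / (1 / 2) : ℂ) = ((2 * Real.pi : ℝ) : ℂ) := by push_cast; ring
  have h3 : (1 / 2 : ℂ) = ((1 / 2 : ℝ) : ℂ) := by push_cast; ring
  rw [h2, h3, ← Complex.ofReal_cpow (by positivity), Real.sqrt_eq_rpow]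
  push_cast
  congr 2
  ring

/-- The Fourier transform turns powers into Hermite polynomials. -/
theorem integral_gaussianMoment (l : ℕ) (x : ℝ) :
    ∫ s, gaussianMoment l x s
      = (Real.sqrt (2 * Real.pi) * (aeval x (hermite l) * Real.exp (-(x ^ 2 / 2))) : ℝ) := by
  have hg (l : ℕ) (x : ℝ) : HasDerivAt (fun y : ℝ => aeval y (hermite l) * Real.exp (-(y ^ 2 / 2)))
      (-(aeval x (hermite (l + 1)) * Real.exp (-(x ^ 2 / 2)))) x := by
    have h1 : HasDerivAt (fun y : ℝ => Real.exp (-(y ^ 2 / 2))) (Real.exp (-(x ^ 2 / 2)) * (-x)) x := by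
      have h0 : HasDerivAt (fun y : ℝ => -(y ^ 2 / 2)) (-x) x := by
        refine (((hasDerivAt_id x).pow 2).div_const 2).neg.congr_deriv ?_
        simp
      exact h0.exp
    refine (((hermite l).hasDerivAt_aeval x).mul h1).congr_deriv ?_
    rw [hermite_succ, map_sub, map_mul, aeval_X]
    ring
  induction l generalizing x with
  | zero => rw [integral_gaussianMoment_zero]; simp
  | succ l ih =>
    have h1 := hasDerivAt_integral_gaussianMoment l x
    simp_rw [ih] at h1
    have h2 := ((hg l x).const_mul (Real.sqrt (2 * Real.pi))).ofReal_comp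
    have h3 := h1.unique h2
    rw [neg_eq_iff_eq_neg] at h3
    rw [h3]
    push_cast
    ring

theorem integral_gaussian_mul_aeval (p : ℝ[X]) (σ x : ℝ) :
    Integrable (fun s : ℝ => Complex.exp (-(s * x * Complex.I))
      * ((Real.exp (-(1 / 2) * s ^ 2) : ℝ) * aeval (s * Complex.I / σ : ℂ) p)) ∧
    ∫ s : ℝ, Complex.exp (-(s * x * Complex.I))
      * ((Real.exp (-(1 / 2) * s ^ 2) : ℝ) * aeval (s * Complex.I / σ : ℂ) p)
      = (Real.sqrt (2 * Real.pi) * Real.exp (-(x ^ 2 / 2))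
        * p.sum fun l a => a / σ ^ l * aeval x (hermite l) : ℝ) := by
  have h (s : ℝ) : Complex.exp (-(s * x * Complex.I))
      * ((Real.exp (-(1 / 2) * s ^ 2) : ℝ) * aeval (s * Complex.I / σ : ℂ) p)
      = ∑ l ∈ p.support, (p.coeff l / σ ^ l : ℝ) * gaussianMoment l x s := by
    rw [aeval_eq_sum_range' (Nat.lt_succ_self _), ← Finset.sum_subset p.supp_subset_range_natDegree_succ
      (fun l _ hl => by rw [notMem_support_iff.1 hl, zero_smul]), Finset.mul_sum, Finset.mul_sum]
    refine Finset.sum_congr rfl fun l _ => ?_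
    rw [gaussianMoment, Complex.real_smul, div_pow]
    push_cast
    ring
  simp_rw [h]
  have hI : ∀ l ∈ p.support, Integrable fun s : ℝ =>
      ((p.coeff l / σ ^ l : ℝ) : ℂ) * gaussianMoment l x s :=
    fun l _ => (integrable_gaussianMoment l x).const_mul _
  refine ⟨integrable_finsetSum _ hI, ?_⟩
  rw [integral_finsetSum _ hI, Polynomial.sum, Finset.mul_sum, Complex.ofReal_sum]
  refine Finset.sum_congr rfl fun l _ => ?_
  rw [integral_const_mul, integral_gaussianMoment]
  push_cast
  ring

/-- Fourier inversion of the Edgeworth approximation. -/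
theorem integral_edgeworthChar (κ : ℕ → ℝ) (hκ : 0 < κ 2) (r : ℕ) {n : ℕ} (hn : 1 ≤ n) (k : ℤ) :
    Integrable (fun t : ℝ => Complex.exp (-(t * Complex.I * k)) * edgeworthChar κ r n t) ∧
    ∫ t : ℝ, Complex.exp (-(t * Complex.I * k)) * edgeworthChar κ r n t
      = (2 * Real.pi : ℂ) * (Real.exp (-((k - κ 1 * n) / (Real.sqrt (κ 2) * Real.sqrt n)) ^ 2 / 2)
        / (Real.sqrt (κ 2) * Real.sqrt (2 * Real.pi * n)) * ∑ j ∈ Finset.range (r + 1),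
          (Real.sqrt n)⁻¹ ^ j
            * edgeworthQ κ j ((k - κ 1 * n) / (Real.sqrt (κ 2) * Real.sqrt n)) : ℝ) := by
  have hn' : (0 : ℝ) < n := by exact_mod_cast hn
  set σ := Real.sqrt (κ 2)
  set q := Real.sqrt n
  have hσ : 0 < σ := Real.sqrt_pos.2 hκ
  have hq : 0 < q := Real.sqrt_pos.2 hn'
  set x := (k - κ 1 * n) / (σ * q)
  set g : ℝ → ℂ := fun s => ∑ j ∈ Finset.range (r + 1), ((q⁻¹ : ℝ) : ℂ) ^ j
    * (Complex.exp (-(s * x * Complex.I))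
      * ((Real.exp (-(1 / 2) * s ^ 2) : ℝ) * aeval (s * Complex.I / σ : ℂ) (edgeworthP κ j)))
  have hg (t : ℝ) : Complex.exp (-(t * Complex.I * k)) * edgeworthChar κ r n t = g (σ * q * t) := by
    have hσC : (σ : ℂ) ≠ 0 := by exact_mod_cast hσ.ne'
    have hqC : (q : ℂ) ≠ 0 := by exact_mod_cast hq.ne'
    have h1 : (((σ * q * t : ℝ) : ℂ) * Complex.I / σ : ℂ) = q * (t * Complex.I) := by
      push_cast; field_simp
    have hq2 : (q : ℂ) ^ 2 = n := by
      rw [← Complex.ofReal_pow, Real.sq_sqrt hn'.le]; simp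
    have hσ2 : (σ : ℂ) ^ 2 = κ 2 := by
      rw [← Complex.ofReal_pow, Real.sq_sqrt hκ.le]
    have h2 : Complex.exp (-(t * Complex.I * k))
        * Complex.exp (n * (κ 1 * (t * Complex.I) - κ 2 * t ^ 2 / 2))
        = Complex.exp (-((σ * q * t : ℝ) * x * Complex.I))
          * (Real.exp (-(1 / 2) * (σ * q * t) ^ 2) : ℝ) := by
      rw [Complex.ofReal_exp, ← Complex.exp_add, ← Complex.exp_add]
      congr 1
      simp only [x]
      push_cast
      rw [← hσ2, ← hq2]
      field_simp
      ring
    simp only [g]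
    rw [edgeworthChar, ← mul_assoc, h2, Finset.mul_sum]
    refine Finset.sum_congr rfl fun j _ => ?_
    rw [h1]
    ring
  have hG (j : ℕ) := integral_gaussian_mul_aeval (edgeworthP κ j) σ x
  have hI : ∀ j ∈ Finset.range (r + 1), Integrable fun s : ℝ => ((q⁻¹ : ℝ) : ℂ) ^ j
      * (Complex.exp (-(s * x * Complex.I))
        * ((Real.exp (-(1 / 2) * s ^ 2) : ℝ) * aeval (s * Complex.I / σ : ℂ) (edgeworthP κ j))) :=
    fun j _ => (hG j).1.const_mul _
  simp_rw [hg]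
  refine ⟨(integrable_finsetSum _ hI).comp_mul_left' (by positivity), ?_⟩
  rw [Measure.integral_comp_mul_left g, integral_finsetSum _ hI]
  simp_rw [integral_const_mul, (hG _).2]
  have h2pi : Real.sqrt (2 * Real.pi * n) = Real.sqrt (2 * Real.pi) * q :=
    Real.sqrt_mul (by positivity) _
  have hpi : (2 * Real.pi : ℂ) = (Real.sqrt (2 * Real.pi) * Real.sqrt (2 * Real.pi) : ℝ) := by
    rw [Real.mul_self_sqrt (by positivity)]; push_cast; ring
  have hs : 0 < Real.sqrt (2 * Real.pi) := Real.sqrt_pos.2 (by positivity)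
  rw [hpi, h2pi, abs_of_pos (by positivity), Complex.real_smul]
  simp_rw [← Complex.ofReal_pow, ← Complex.ofReal_mul]
  rw [← Complex.ofReal_sum, ← Complex.ofReal_mul]
  congr 1
  rw [Finset.mul_sum, Finset.mul_sum, Finset.mul_sum]
  refine Finset.sum_congr rfl fun j _ => ?_
  have hQ : edgeworthQ κ j x
      = (edgeworthP κ j).sum fun l a => a / σ ^ l * aeval x (hermite l) := rfl
  rw [hQ, neg_div]
  field_simp

end Gaussian

/-! ### The uniform local expansion -/

section LocalExpansion

open Finset Filter Topology

variable {c : ℤ → ℝ≥0∞}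

/-- The cumulant generating function of a weight on the integers. -/
noncomputable abbrev siteCGF (c : ℤ → ℝ≥0∞) : ℝ → ℝ :=
  cgf (fun k : ℤ => (k : ℝ)) (siteMeasure c)

theorem siteMGF_ofReal_eq_exp (hs : Aperiodic {k | 0 < c k}) {β : ℝ} (hβ : β ∈ siteExpSet c) :
    siteMGF c β = (Real.exp (siteCGF c β) : ℝ) := by
  obtain ⟨k, hk⟩ := hs.nontrivial.nonempty
  rw [siteMGF_ofReal, siteCGF, cgf, Real.exp_log (mgf_pos' (siteMeasure_ne_zero hk) hβ)]

theorem continuousOn_iteratedDeriv_siteCGF (c : ℤ → ℝ≥0∞) (j : ℕ) :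
    ContinuousOn (iteratedDeriv j (siteCGF c)) (interior (siteExpSet c)) := by
  intro β hβ
  rw [iteratedDeriv_eq_iterate]
  exact ((analyticAt_cgf hβ).iterated_deriv j).continuousAt.continuousWithinAt

/-- Away from the real axis the normalized generating function is bounded by a constant less
than `1`, uniformly on compact sets of parameters. -/
theorem exists_norm_siteMGF_le (hc : ∀ k, c k ≠ ⊤) (hs : Aperiodic {k | 0 < c k}) {K : Set ℝ}
    (hK : IsCompact K) (hKD : K ⊆ interior (siteExpSet c)) {δ : ℝ} (hδ : 0 < δ) :
    ∃ q : ℝ, 0 ≤ q ∧ q < 1 ∧ ∀ β ∈ K, ∀ t : ℝ, δ ≤ |t| → |t| ≤ Real.pi →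
      ‖siteMGF c (β + t * Complex.I)‖ ≤ q * Real.exp (siteCGF c β) := by
  have hS : IsCompact {t : ℝ | δ ≤ |t| ∧ |t| ≤ Real.pi} := by
    refine (isCompact_Icc (a := -Real.pi) (b := Real.pi)).of_isClosed_subset ?_ fun t ht =>
      abs_le.1 ht.2
    exact (isClosed_le continuous_const continuous_abs).inter
      (isClosed_le continuous_abs continuous_const)
  have hcont : ContinuousOn (fun p : ℝ × ℝ =>
      1 - ‖siteMGF c (p.1 + p.2 * Complex.I)‖ / Real.exp (siteCGF c p.1))
      (K ×ˢ {t : ℝ | δ ≤ |t| ∧ |t| ≤ Real.pi}) := by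
    intro p hp
    have h1 : AnalyticAt ℂ (siteMGF c) (p.1 + p.2 * Complex.I) :=
      analyticAt_siteMGF (by simpa using hKD hp.1)
    have h2 : ContinuousAt (fun p : ℝ × ℝ => siteMGF c (p.1 + p.2 * Complex.I)) p :=
      ContinuousAt.comp (f := fun p : ℝ × ℝ => (p.1 + p.2 * Complex.I : ℂ)) h1.continuousAt
        (by fun_prop)
    have h3 : ContinuousAt (fun p : ℝ × ℝ => Real.exp (siteCGF c p.1)) p :=
      (Real.continuous_exp.continuousAt).comp
        (ContinuousAt.comp (f := Prod.fst) (analyticAt_cgf (hKD hp.1)).continuousAt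
          continuousAt_fst)
    exact (continuousAt_const.sub (h2.norm.div h3 (Real.exp_pos _).ne')).continuousWithinAt
  have hpos : ∀ p ∈ K ×ˢ {t : ℝ | δ ≤ |t| ∧ |t| ≤ Real.pi},
      0 < 1 - ‖siteMGF c (p.1 + p.2 * Complex.I)‖ / Real.exp (siteCGF c p.1) := by
    intro p hp
    have h0 := interior_subset (hKD hp.1)
    have ht0 : p.2 ≠ 0 := fun h => by
      have := hp.2.1
      rw [h, abs_zero] at this
      linarith
    have h1 := norm_siteMGF_lt hc hs h0 ht0 hp.2.2
    have h2 : mgf (fun k : ℤ => (k : ℝ)) (siteMeasure c) p.1 = Real.exp (siteCGF c p.1) := by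
      have := siteMGF_ofReal_eq_exp hs h0
      rw [siteMGF_ofReal] at this
      exact_mod_cast this
    rw [h2] at h1
    rw [sub_pos, div_lt_one (Real.exp_pos _)]
    exact h1
  obtain ⟨a, ha, h⟩ := (hK.prod hS).exists_forall_le' hcont hpos
  refine ⟨max (1 - a) 0, le_max_right _ _, max_lt (by linarith) one_pos, fun β hβ t h1 h2 => ?_⟩
  have h3 := h (β, t) ⟨hβ, h1, h2⟩
  rw [← div_le_iff₀ (Real.exp_pos _)]
  exact le_trans (by linarith) (le_max_left _ _)

/-- Comparison of the characteristic function and its Edgeworth approximation on the whole line,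
uniformly on compact sets of parameters. -/
theorem exists_norm_indicator_sub_edgeworthChar_le (hc : ∀ k, c k ≠ ⊤)
    (hs : Aperiodic {k | 0 < c k}) {K : Set ℝ} (hK : IsCompact K)
    (hKD : K ⊆ interior (siteExpSet c)) (r : ℕ) :
    ∃ A b q : ℝ, 0 ≤ A ∧ 0 < b ∧ 0 ≤ q ∧ q < 1 ∧ ∀ β ∈ K, ∀ n : ℕ, 1 ≤ n → ∀ t : ℝ,
      ‖(Set.Ioc (-Real.pi) Real.pi).indicator (fun t : ℝ =>
          (siteMGF c (β + t * Complex.I) / (Real.exp (siteCGF c β) : ℝ)) ^ n) t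
        - edgeworthChar (fun j => iteratedDeriv j (siteCGF c) β) r n t‖
      ≤ A * (Real.sqrt n)⁻¹ ^ (r + 1) * ((1 + |Real.sqrt n * t|) ^ (4 * (r + 1))
          * Real.exp (-b * (Real.sqrt n * t) ^ 2))
        + (Set.Ioc (-Real.pi) Real.pi).indicator (fun _ => q ^ n) t := by
  set D := interior (siteExpSet c)
  have hψ : ∀ x ∈ D, siteMGF c x = (Real.exp (siteCGF c x) : ℝ) := fun x hx =>
    siteMGF_ofReal_eq_exp hs (interior_subset hx)
  have hM : ∀ x ∈ D, AnalyticAt ℂ (siteMGF c) x := fun x hx => analyticAt_siteMGF (by simpa using hx)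
  obtain ⟨c0, hc0, hκ2⟩ := hK.exists_forall_le'
    ((continuousOn_iteratedDeriv_siteCGF c 2).mono hKD)
    (fun β hβ => iteratedDeriv_two_cgf_pos hc hs.nontrivial (hKD hβ))
  obtain ⟨δ3, hδ3, C3, h3⟩ :=
    exists_norm_log_sub_taylor_le isOpen_interior hM hψ hK hKD 3
  obtain ⟨δr, hδr, Cr, hr⟩ :=
    exists_norm_log_sub_taylor_le isOpen_interior hM hψ hK hKD (r + 3)
  have hbd (j : ℕ) : ∃ B : ℝ, ∀ β ∈ K,
      ‖iteratedDeriv (j + 2) (siteCGF c) β / ((j + 2).factorial : ℝ)‖ ≤ B :=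
    hK.exists_bound_of_continuousOn
      (((continuousOn_iteratedDeriv_siteCGF c (j + 2)).mono hKD).div_const _)
  choose B' hB' using hbd
  obtain ⟨B, hB1, hBr, hBκ⟩ : ∃ B : ℝ, 1 ≤ B ∧ Cr ≤ B ∧ ∀ β ∈ K, ∀ j ≤ r,
      |iteratedDeriv (j + 2) (siteCGF c) β / ((j + 2).factorial : ℝ)| ≤ B := by
    have h0 : 0 ≤ ∑ j ∈ range (r + 1), |B' j| := sum_nonneg fun _ _ => abs_nonneg _
    refine ⟨1 + |Cr| + ∑ j ∈ range (r + 1), |B' j|, by linarith [abs_nonneg Cr],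
      by linarith [le_abs_self Cr], fun β hβ j hj => ?_⟩
    have h1 := single_le_sum (f := fun j => |B' j|) (fun _ _ => abs_nonneg _)
      (mem_range.2 (Nat.lt_succ_of_le hj))
    have h2 := hB' j β hβ
    rw [Real.norm_eq_abs] at h2
    linarith [abs_nonneg Cr, le_abs_self (B' j)]
  obtain ⟨C, hC0, hC⟩ := exists_norm_exp_sub_edgeworthChar_le r
  -- `δ` is so small that the cubic remainder uses up at most half of the Gaussian exponent
  obtain ⟨δ, hδ, hδ1, hδ3', hδr', hδc⟩ : ∃ δ > 0, δ ≤ 1 ∧ δ ≤ δ3 ∧ δ ≤ δr ∧ |C3| * δ ≤ c0 / 4 := by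
    refine ⟨min (min 1 (min δ3 δr)) (c0 / 4 / (|C3| + 1)), by positivity,
      (min_le_left _ _).trans (min_le_left _ _),
      (min_le_left _ _).trans ((min_le_right _ _).trans (min_le_left _ _)),
      (min_le_left _ _).trans ((min_le_right _ _).trans (min_le_right _ _)), ?_⟩
    calc |C3| * _ ≤ (|C3| + 1) * (c0 / 4 / (|C3| + 1)) := by
          gcongr
          · linarith
          · exact min_le_right _ _
      _ = c0 / 4 := by field_simp
  obtain ⟨q, hq0, hq1, hq⟩ := exists_norm_siteMGF_le hc hs hK hKD hδ
  refine ⟨C * B ^ (r + 1) + (r + 1) ^ (r + 2) * B ^ r * (δ⁻¹) ^ (r + 1), c0 / 4, q, by positivity,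
    by positivity, hq0, hq1, fun β hβ n hn t => ?_⟩
  have hn' : (0 : ℝ) < n := by exact_mod_cast hn
  set κ : ℕ → ℝ := fun j => iteratedDeriv j (siteCGF c) β
  have hκ2β : c0 ≤ κ 2 := hκ2 β hβ
  set s := Real.sqrt n
  have hs0 : 0 < s := Real.sqrt_pos.2 hn'
  have hst : |s * t| = s * |t| := by rw [abs_mul, abs_of_pos hs0]
  have hs2 : (s * t) ^ 2 = n * t ^ 2 := by rw [mul_pow, Real.sq_sqrt hn'.le]
  have hy1 : 1 ≤ 1 + s * |t| := by
    have : 0 ≤ s * |t| := by positivity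
    linarith
  have hind : 0 ≤ (Set.Ioc (-Real.pi) Real.pi).indicator (fun _ : ℝ => q ^ n) t :=
    Set.indicator_nonneg (fun _ _ => by positivity) t
  rw [hst, hs2]
  have hexp4 : Real.exp (-(n * κ 2 * t ^ 2 / 4)) ≤ Real.exp (-(c0 / 4) * (n * t ^ 2)) := by
    rw [Real.exp_le_exp]
    have : c0 * (n * t ^ 2) ≤ κ 2 * (n * t ^ 2) := by gcongr
    linarith
  rcases le_or_gt (|t|) δ with ht | ht
  · have hmem : t ∈ Set.Ioc (-Real.pi) Real.pi := by
      have h1 := abs_le.1 (ht.trans hδ1)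
      have h2 := Real.pi_gt_three
      exact ⟨by linarith, by linarith⟩
    have hexp : (siteMGF c (β + t * Complex.I) / (Real.exp (siteCGF c β) : ℝ)) ^ n
        = Complex.exp (n * (Complex.log (siteMGF c (β + t * Complex.I)) - (κ 0 : ℝ))) := by
      rw [Complex.exp_nat_mul, Complex.exp_sub, Complex.exp_log (h3 β hβ t (ht.trans hδ3')).1]
      simp [κ]
    rw [Set.indicator_of_mem hmem, hexp]
    refine (hC κ B n t _ hB1 hn (hBκ β hβ) ?_ ?_).trans ?_
    · refine (h3 β hβ t (ht.trans hδ3')).2.trans ?_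
      calc C3 * |t| ^ 3 ≤ |C3| * |t| ^ 3 := by gcongr; exact le_abs_self _
        _ = |C3| * |t| * t ^ 2 := by rw [← sq_abs t]; ring
        _ ≤ |C3| * δ * t ^ 2 := by gcongr
        _ ≤ c0 / 4 * t ^ 2 := by gcongr
        _ ≤ κ 2 / 4 * t ^ 2 := by gcongr
        _ = κ 2 * t ^ 2 / 4 := by ring
    · refine (hr β hβ t (ht.trans hδr')).2.trans ?_
      gcongr
    · calc C * (B * (1 + s * |t|) ^ 3 * s⁻¹) ^ (r + 1) * Real.exp (-(n * κ 2 * t ^ 2 / 4))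
          = C * B ^ (r + 1) * s⁻¹ ^ (r + 1) * ((1 + s * |t|) ^ (3 * (r + 1))
            * Real.exp (-(n * κ 2 * t ^ 2 / 4))) := by
            rw [mul_pow, mul_pow, ← pow_mul]; ring
        _ ≤ (C * B ^ (r + 1) + (r + 1) ^ (r + 2) * B ^ r * (δ⁻¹) ^ (r + 1)) * s⁻¹ ^ (r + 1)
            * ((1 + s * |t|) ^ (4 * (r + 1)) * Real.exp (-(c0 / 4) * (n * t ^ 2))) := by
            gcongr ?_ * _ * (?_ * ?_)
            · exact le_add_of_nonneg_right (by positivity)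
            · exact pow_le_pow_right₀ hy1 (by omega)
        _ ≤ _ := le_add_of_nonneg_right hind
  · have hind2 : ‖(Set.Ioc (-Real.pi) Real.pi).indicator (fun t : ℝ =>
        (siteMGF c (β + t * Complex.I) / (Real.exp (siteCGF c β) : ℝ)) ^ n) t‖
        ≤ (Set.Ioc (-Real.pi) Real.pi).indicator (fun _ => q ^ n) t := by
      by_cases hmem : t ∈ Set.Ioc (-Real.pi) Real.pi
      · rw [Set.indicator_of_mem hmem, Set.indicator_of_mem hmem, norm_pow, norm_div,
          Complex.norm_real, Real.norm_of_nonneg (Real.exp_pos _).le]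
        gcongr
        rw [div_le_iff₀ (Real.exp_pos _)]
        exact hq β hβ t ht.le (abs_le.2 ⟨hmem.1.le, hmem.2⟩)
      · rw [Set.indicator_of_notMem hmem, Set.indicator_of_notMem hmem, norm_zero]
    have hchar := norm_edgeworthChar_le hB1 (hBκ β hβ) hn t (κ := κ)
    -- outside `[-δ, δ]`, powers of `|t| / δ ≥ 1` supply the missing powers of `1 / √n`
    have hone : 1 ≤ s⁻¹ ^ (r + 1) * (δ⁻¹ ^ (r + 1) * (1 + s * |t|) ^ (r + 1)) := by
      rw [← mul_pow, ← mul_pow]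
      refine one_le_pow₀ ?_
      calc 1 ≤ δ⁻¹ * |t| := by
            rw [inv_mul_eq_div, one_le_div hδ]; exact ht.le
        _ = s⁻¹ * (δ⁻¹ * (s * |t|)) := by field_simp
        _ ≤ _ := by gcongr; linarith
    have hexp2 : Real.exp (-(n * κ 2 * t ^ 2 / 2)) ≤ Real.exp (-(c0 / 4) * (n * t ^ 2)) := by
      refine le_trans ?_ hexp4
      rw [Real.exp_le_exp]
      have : 0 ≤ κ 2 * (n * t ^ 2) := by
        have : 0 ≤ κ 2 := hc0.le.trans hκ2β
        positivity
      linarith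
    have hE : ‖edgeworthChar κ r n t‖
        ≤ (C * B ^ (r + 1) + (r + 1) ^ (r + 2) * B ^ r * (δ⁻¹) ^ (r + 1)) * s⁻¹ ^ (r + 1)
            * ((1 + s * |t|) ^ (4 * (r + 1)) * Real.exp (-(c0 / 4) * (n * t ^ 2))) := by
      calc _ ≤ (r + 1) ^ (r + 2) * (B * (1 + s * |t|) ^ 3) ^ r
              * Real.exp (-(n * κ 2 * t ^ 2 / 2)) := hchar
        _ ≤ (r + 1) ^ (r + 2) * (B * (1 + s * |t|) ^ 3) ^ r * Real.exp (-(c0 / 4) * (n * t ^ 2))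
              * (s⁻¹ ^ (r + 1) * (δ⁻¹ ^ (r + 1) * (1 + s * |t|) ^ (r + 1))) := by
            refine le_trans ?_ (le_mul_of_one_le_right (by positivity) hone)
            gcongr
        _ = (r + 1) ^ (r + 2) * B ^ r * (δ⁻¹) ^ (r + 1) * s⁻¹ ^ (r + 1)
              * ((1 + s * |t|) ^ (3 * r + (r + 1)) * Real.exp (-(c0 / 4) * (n * t ^ 2))) := by
            rw [mul_pow, ← pow_mul, pow_add]; ring
        _ ≤ _ := by
            gcongr ?_ * _ * (?_ * _)
            · exact le_add_of_nonneg_left (by positivity)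
            · exact pow_le_pow_right₀ hy1 (by omega)
    calc _ ≤ _ := norm_sub_le _ _
      _ ≤ _ := (add_le_add hind2 hE).trans (add_comm _ _).le

/-- The local Edgeworth expansion of the convolution powers of a weight on `ℤ`, with an explicit
rate that is uniform in the site and in compact sets of parameters. -/
theorem exists_abs_sub_edgeworth_le (hc : ∀ k, c k ≠ ⊤)
    (hs : Aperiodic {k | 0 < c k}) {K : Set ℝ} (hK : IsCompact K)
    (hKD : K ⊆ interior (siteExpSet c)) {a : ℕ → ℤ → ℝ}
    (ha0 : ∀ k, a 0 k = if k = 0 then 1 else 0)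
    (ha : ∀ n k, HasSum (fun j => (c j).toReal * a n (k - j)) (a (n + 1) k)) (r : ℕ) :
    ∃ C q : ℝ, 0 ≤ C ∧ 0 ≤ q ∧ q < 1 ∧ ∀ β ∈ K, ∀ n : ℕ, 1 ≤ n → ∀ k : ℤ, ∀ κ : ℕ → ℝ,
      (κ = fun j => iteratedDeriv j (siteCGF c) β) →
      |Real.exp (β * k - siteCGF c β * n) * a n k -
        Real.exp (-((k - κ 1 * n) / (Real.sqrt (κ 2) * Real.sqrt n)) ^ 2 / 2)
          / (Real.sqrt (κ 2) * Real.sqrt (2 * Real.pi * n)) * ∑ j ∈ range (r + 1),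
          (Real.sqrt n)⁻¹ ^ j
            * edgeworthQ κ j ((k - κ 1 * n) / (Real.sqrt (κ 2) * Real.sqrt n))|
        ≤ C * (Real.sqrt n)⁻¹ ^ (r + 2) + q ^ n := by
  obtain ⟨A, b, q, hA, hb, hq0, hq1, h⟩ :=
    exists_norm_indicator_sub_edgeworthChar_le hc hs hK hKD r
  have hJi := integrable_one_add_abs_pow_mul_exp_neg_mul_sq hb (4 * (r + 1))
  set J := ∫ y : ℝ, (1 + |y|) ^ (4 * (r + 1)) * Real.exp (-b * y ^ 2) with hJ
  have hJ0 : 0 ≤ J := integral_nonneg fun y => by positivity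
  refine ⟨A * J / (2 * Real.pi), q, by positivity, hq0, hq1, fun β hβ n hn k κ hκ => ?_⟩
  have hn' : (0 : ℝ) < n := by exact_mod_cast hn
  have hβD := hKD hβ
  have hκ2 : 0 < κ 2 := by
    rw [hκ]; exact iteratedDeriv_two_cgf_pos hc hs.nontrivial hβD
  have hpi := Real.pi_pos
  obtain ⟨hEi, hE⟩ := integral_edgeworthChar κ hκ2 r hn k
  set main := Real.exp (-((k - κ 1 * n) / (Real.sqrt (κ 2) * Real.sqrt n)) ^ 2 / 2)
          / (Real.sqrt (κ 2) * Real.sqrt (2 * Real.pi * n)) * ∑ j ∈ range (r + 1),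
          (Real.sqrt n)⁻¹ ^ j
            * edgeworthQ κ j ((k - κ 1 * n) / (Real.sqrt (κ 2) * Real.sqrt n))
  set s := Real.sqrt n
  have hs0 : 0 < s := Real.sqrt_pos.2 hn'
  set f : ℝ → ℂ := fun t => (siteMGF c (β + t * Complex.I) / (Real.exp (siteCGF c β) : ℝ)) ^ n
  have hfc : Continuous fun t : ℝ => Complex.exp (-(t * Complex.I * k)) * f t := by
    have := continuous_siteMGF_vertical hβD
    simp only [f]
    fun_prop
  have hinv : (2 * Real.pi : ℂ) * (Real.exp (β * k - siteCGF c β * n) * a n k : ℝ)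
      = ∫ t, (Set.Ioc (-Real.pi) Real.pi).indicator
        (fun t : ℝ => Complex.exp (-(t * Complex.I * k)) * f t) t := by
    rw [integral_indicator measurableSet_Ioc,
      ← intervalIntegral.integral_of_le (by linarith)]
    have h1 := fourier_inversion_convolution_power hc hβD ha0 ha n k
    have h2 : Real.exp (β * k - siteCGF c β * n) * a n k
        = (Real.exp (siteCGF c β) ^ n)⁻¹ * (Real.exp (β * k) * a n k) := by
      rw [← Real.exp_nat_mul, ← Real.exp_neg, ← mul_assoc, ← Real.exp_add]
      ring_nf
    rw [h2, Complex.ofReal_mul, mul_left_comm, h1, ← intervalIntegral.integral_const_mul]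
    refine intervalIntegral.integral_congr fun t _ => ?_
    simp only [f, div_pow]
    push_cast
    ring
  have hfi : Integrable ((Set.Ioc (-Real.pi) Real.pi).indicator
      (fun t : ℝ => Complex.exp (-(t * Complex.I * k)) * f t)) := by
    rw [integrable_indicator_iff measurableSet_Ioc]
    exact hfc.integrableOn_Ioc
  have hdiff : (2 * Real.pi : ℂ) * ((Real.exp (β * k - siteCGF c β * n) * a n k - main : ℝ) : ℂ)
      = ∫ t, ((Set.Ioc (-Real.pi) Real.pi).indicator
        (fun t : ℝ => Complex.exp (-(t * Complex.I * k)) * f t) t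
        - Complex.exp (-(t * Complex.I * k)) * edgeworthChar κ r n t) := by
    rw [integral_sub hfi hEi, ← hinv, hE, Complex.ofReal_sub, mul_sub]
  have hscaled : Integrable fun t : ℝ =>
      (1 + |s * t|) ^ (4 * (r + 1)) * Real.exp (-b * (s * t) ^ 2) :=
    hJi.comp_mul_left' hs0.ne'
  have hconst : Integrable ((Set.Ioc (-Real.pi) Real.pi).indicator fun _ : ℝ => q ^ n) := by
    rw [integrable_indicator_iff measurableSet_Ioc]
    exact integrableOn_const (by simp)
  have hle : ‖(2 * Real.pi : ℂ) * ((Real.exp (β * k - siteCGF c β * n) * a n k - main : ℝ) : ℂ)‖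
      ≤ ∫ t, (A * s⁻¹ ^ (r + 1) * ((1 + |s * t|) ^ (4 * (r + 1)) * Real.exp (-b * (s * t) ^ 2))
        + (Set.Ioc (-Real.pi) Real.pi).indicator (fun _ => q ^ n) t) := by
    rw [hdiff]
    refine norm_integral_le_of_norm_le ((hscaled.const_mul _).add hconst)
      (Eventually.of_forall fun t => ?_)
    have h1 : (Set.Ioc (-Real.pi) Real.pi).indicator
        (fun t : ℝ => Complex.exp (-(t * Complex.I * k)) * f t) t
        = Complex.exp (-(t * Complex.I * k)) * (Set.Ioc (-Real.pi) Real.pi).indicator f t := by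
      rw [Set.indicator_mul_right]
    have h2 : ‖Complex.exp (-(t * Complex.I * k))‖ = 1 := by
      rw [Complex.norm_exp]; simp
    rw [h1, ← mul_sub, norm_mul, h2, one_mul, hκ]
    exact h β hβ n hn t
  rw [integral_add (hscaled.const_mul _) hconst, integral_const_mul,
    Measure.integral_comp_mul_left (fun y => (1 + |y|) ^ (4 * (r + 1)) * Real.exp (-b * y ^ 2)),
    ← hJ, integral_indicator measurableSet_Ioc, setIntegral_const, norm_mul,
    Complex.norm_real, Real.norm_eq_abs] at hle
  have h2pi : ‖(2 * Real.pi : ℂ)‖ = 2 * Real.pi := by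
    simp [abs_of_pos hpi]
  have hvol : volume.real (Set.Ioc (-Real.pi) Real.pi) = 2 * Real.pi := by
    rw [Real.volume_real_Ioc_of_le (by linarith)]; ring
  rw [h2pi, hvol, abs_of_pos (by positivity : 0 < s⁻¹), smul_eq_mul, smul_eq_mul] at hle
  refine le_of_mul_le_mul_left (hle.trans_eq ?_) (by positivity : 0 < 2 * Real.pi)
  rw [mul_add, ← mul_assoc (2 * Real.pi), mul_div_cancel₀ (A * J) (by positivity)]
  ring

end LocalExpansion

theorem rpow_neg_natCast_div_two {x : ℝ} (hx : 0 ≤ x) (j : ℕ) :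
    x ^ (-(j : ℝ) / 2) = (Real.sqrt x)⁻¹ ^ j := by
  rw [Real.sqrt_eq_rpow, ← Real.rpow_neg hx, ← Real.rpow_natCast, ← Real.rpow_mul hx]
  congr 1
  ring

open Filter Topology in
/-- Both error terms of the local expansion are of smaller order than its last term. -/
theorem exists_forall_pow_add_pow_le {C q ε : ℝ} (hq0 : 0 ≤ q) (hq1 : q < 1) (hε : 0 < ε)
    (r : ℕ) : ∃ N : ℕ, ∀ n : ℕ, N ≤ n → 1 ≤ n ∧
      C * (Real.sqrt n)⁻¹ ^ (r + 2) + q ^ n ≤ ε * (Real.sqrt n)⁻¹ ^ (r + 1) := by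
  have h1 : Tendsto (fun n : ℕ => C * (Real.sqrt n)⁻¹ + (n : ℝ) ^ (r + 1) * q ^ n) atTop (𝓝 0) := by
    have h2 : Tendsto (fun n : ℕ => (Real.sqrt n)⁻¹) atTop (𝓝 0) :=
      (Real.tendsto_sqrt_atTop.comp tendsto_natCast_atTop_atTop).inv_tendsto_atTop
    have h3 := tendsto_pow_const_mul_const_pow_of_abs_lt_one (r + 1) (r := q)
      (by rwa [abs_of_nonneg hq0])
    simpa using (h2.const_mul C).add h3
  obtain ⟨N, hN⟩ := eventually_atTop.1 ((h1.eventually_le_const hε).and (eventually_ge_atTop 1))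
  refine ⟨N, fun n hn => ⟨(hN n hn).2, ?_⟩⟩
  obtain ⟨h2, h3⟩ := hN n hn
  have hn1 : (1 : ℝ) ≤ n := by exact_mod_cast h3
  set s := Real.sqrt n
  have hs1 : 1 ≤ s := Real.one_le_sqrt.2 hn1
  have hsn : s ≤ n := by
    rw [← Real.sq_sqrt (zero_le_one.trans hn1)]
    exact le_self_pow₀ hs1 two_ne_zero
  have h4 : q ^ n ≤ (n : ℝ) ^ (r + 1) * q ^ n * s⁻¹ ^ (r + 1) := by
    rw [mul_right_comm, inv_pow]
    refine le_mul_of_one_le_left (by positivity) ?_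
    rw [← div_eq_mul_inv, one_le_div (by positivity)]
    gcongr
  calc _ ≤ C * s⁻¹ ^ (r + 2) + (n : ℝ) ^ (r + 1) * q ^ n * s⁻¹ ^ (r + 1) := by gcongr
    _ = (C * s⁻¹ + (n : ℝ) ^ (r + 1) * q ^ n) * s⁻¹ ^ (r + 1) := by ring
    _ ≤ _ := by gcongr

theorem mainTheorem7 {Ω : Type*} [MeasurableSpace Ω] (P : Measure Ω) [IsProbabilityMeasure P]
    (X : BranchingRandomWalk P) (hA : X.AssumptionA) (hC : X.AssumptionC) (hE : X.AssumptionE)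
    (r : ℕ) (K : Set ℝ) (hK : IsCompact K) (hKD : K ⊆ X.domPhi) :
    (∀ (n : ℕ) (k : ℤ), X.intensity n k ≠ ⊤) ∧
    ∀ ε : ℝ, 0 < ε → ∃ N : ℕ, ∀ n : ℕ, N ≤ n → ∀ β ∈ K, ∀ k : ℤ,
      |Real.exp (β * k - X.phiReal β * n) * (X.intensity n k).toReal -
          Real.exp (-(X.coord β n k) ^ 2 / 2) / (X.sigma β * Real.sqrt (2 * Real.pi * n)) *
            ∑ j ∈ Finset.range (r + 1),
              (n : ℝ) ^ (-(j : ℝ) / 2) * edgeworthQ (fun i => X.kappa i β) j (X.coord β n k)|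
        ≤ ε * (n : ℝ) ^ (-((r : ℝ) + 1) / 2) := by
  obtain ⟨a, b, ha, hb, hab⟩ := hC
  have h0 : X.PhiFinite 0 := hab 0 ⟨ha, hb⟩
  have hfin := X.intensity_ne_top h0
  refine ⟨hfin, fun ε hε => ?_⟩
  obtain ⟨C, q, -, hq0, hq1, h⟩ := exists_abs_sub_edgeworth_le (c := X.intensity 1) (hfin 1)
    hE.aperiodic hK (by rwa [BranchingRandomWalk.domPhi_eq hE] at hKD)
    (a := fun n k => (X.intensity n k).toReal)
    (fun k => by rw [X.intensity_zero]; split_ifs <;> simp)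
    (X.hasSum_intensity_succ h0) r
  obtain ⟨N, hN⟩ := exists_forall_pow_add_pow_le (C := C) hq0 hq1 hε r
  refine ⟨N, fun n hn β hβ k => ?_⟩
  obtain ⟨hn1, hle⟩ := hN n hn
  have hmain := h β hβ n hn1 k (fun i => X.kappa i β) (by
    ext j
    rw [BranchingRandomWalk.kappa, X.phiReal_eq_cgf])
  have hr : (n : ℝ) ^ (-((r : ℝ) + 1) / 2) = (Real.sqrt n)⁻¹ ^ (r + 1) := by
    have := rpow_neg_natCast_div_two (Nat.cast_nonneg (α := ℝ) n) (r + 1)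
    rwa [Nat.cast_succ] at this
  simp_rw [rpow_neg_natCast_div_two (Nat.cast_nonneg (α := ℝ) n)]
  rw [hr, X.phiReal_eq_cgf]
  exact hmain.trans hle
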